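/- **Theorem 1.5.** Let $(X,\rho)$ be a compact metric space and let $f\colon X\to X$ be continuous, open, topologically transitive (for all nonempty open $U,V\subseteq X$ there is $n\ge 1$ with $f^n(U)\cap V\ne\emptyset$) and distance-expanding: there are $\xi>0$ and $\lambda>1$ such that $\rho(f(x),f(y))\ge\lambda\rho(x,y)$ whenever $\rho(x,y)\le\xi$, and $f|_{B(x,\xi)}$ is a homeomorphism onto its image for each $x\in X$. Let $\alpha=\{A_0,\dots,A_N\}$ be a Markov partition of $X$ with $\operatorname{diam}A_i<\xi$ for all $i$; that is, a finite cover of $X$ by nonempty sets with $A_i=\overline{\operatorname{int}A_i}$, with $\operatorname{int}A_i\cap\operatorname{int}A_j=\emptyset$ for $i\neq j$, and such that $f(\operatorname{int}A_i)\cap\operatorname{int}A_j\neq\emptyset$ implies $\operatorname{int}A_j\subseteq f(\operatorname{int}A_i)$. *Tile graph.* Let $\Gamma$ be the set of finite words $u=u_1\cdots u_n$, $n\ge 0$, with letters in $\{0,\dots,N\}$ and $A_{u_{i+1}}\subseteq f(A_{u_i})$ for $1\le i<n$. Write $|u|=n$, let $o$ be the empty word, and put $A_u=A_{u_1}\cap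 f^{-1}A_{u_2}\cap\dots\cap f^{-(n-1)}A_{u_n}$, $A_o=X$. Distinct $u,v\in\Gamma$ are joined by an edge if and only if $\bigl||u|-|v|\bigr|\le1$ and $A_u\cap A_v\ne\emptyset$; let $d$ be the graph distance. Let $\sigma(u_1u_2\cdots u_n)=u_2\cdots u_n$ for $n\ge1$ and $\sigma(o)=o$. Let $(u|v)=\frac12\bigl(d(u,o)+d(o,v)-d(u,v)\bigr)$. The Gromov boundary of $\Gamma$ is identified with $X$ in the natural way: a sequence $(v_n)$ in $\Gamma$ converges to $x\in X$ if $(v_n|v_m)\to+\infty$ as $n,m\to\infty$ and the sets $A_{v_n}$ converge to $\{x\}$ in the Hausdorff distance. *Random walk.* For each $u\in\Gamma$ let $P(u)$ be a probability measure on $\Gamma$, write $\widehat P(u,v)=P(u)(\{v\})$, and assume: (A) there is $R>0$ such that $\widehat P(u,v)>0$ implies $d(u,v)<R$; (B) $\widehat P(u,v)>0$ implies $|v|>|u|$; (C) if $|v|=|u|+1$ and $d(u,v)=1$, then $\widehat P(u,v)>0$; (D) $P(\sigma u)=\sigma_*P(u)$ for all $u\neq o$. Let $(Z_n)$ be the Markov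 chain with transition probabilities $\widehat P$ and $Z_0=o$, let $G(u,v)=\sum_{n\ge0}\widehat P^{(n)}(u,v)$ be the Green function, where $\widehat P^{(n)}$ denotes the $n$-step transition probabilities, and let $K(u,v)=G(u,v)/G(o,v)$. Let $\widehat K(v)=K(\cdot,v)\in\mathbb R^\Gamma$, and let $\partial_M\Gamma=\overline{\widehat K(\Gamma)}\setminus\widehat K(\Gamma)$ be the Martin boundary, where the closure is taken in the topology of pointwise convergence. Then there is a unique continuous surjection $\Phi\colon\partial_M\Gamma\to X$ extending the identity of $\Gamma$, in the sense that $\widehat K(v_n)\to\zeta\in\partial_M\Gamma$ implies $v_n\to\Phi(\zeta)$; and $\widehat K(Z_n)$ converges almost surely to a random point $Z_\infty\in\partial_M\Gamma$, so that the law $\nu^{\partial_M\Gamma}$ of $Z_\infty$ is well defined. The harmonic measure $\nu=\Phi_*\nu^{\partial_M\Gamma}$ on $X$ is quasi-invariant under $f$: the measures $\nu$ and $f_*\nu$ are mutually absolutely continuous, and both Radon–Nikodym derivatives $\frac{d\nu}{d(f_*\nu)}$ and $\frac{d(f_*\nu)}{d\nu}$ are (essentially) bounded. -/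

import Mathlib

open Set Filter Topology MeasureTheory ProbabilityTheory
open scoped ENNReal NNReal

noncomputable section

namespace TileGraph

/-! ## Distance-expanding maps and Markov partitions -/

/-- `f` is distance-expanding at scale `ξ` with factor `lam`, and restricts to a homeomorphism onto
its image on every open ball of radius `ξ`. -/
structure IsDistanceExpanding {X : Type*} [MetricSpace X] (f : X → X) (ξ lam : ℝ) : Prop where
  scale_pos : 0 < ξ
  one_lt_factor : 1 < lam
  expanding : ∀ x y : X, dist x y ≤ ξ → lam * dist x y ≤ dist (f x) (f y)
  homeo_on_ball : ∀ x : X, IsEmbedding (fun y : Metric.ball x ξ => f y)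

/-- Topological transitivity of the forward iterates of `f`. -/
def IsTransitive {X : Type*} [TopologicalSpace X] (f : X → X) : Prop :=
  ∀ U V : Set X, IsOpen U → IsOpen V → U.Nonempty → V.Nonempty →
    ∃ n : ℕ, 0 < n ∧ (f^[n] '' U ∩ V).Nonempty

/-- Open, transitive, distance-expanding maps, with expansion data `ξ`, `lam`. -/
structure IsExpandingSystem {X : Type*} [MetricSpace X] (f : X → X) (ξ lam : ℝ) : Prop where
  continuous : Continuous f
  transitive : IsTransitive f
  isOpenMap : IsOpenMap f
  expanding : IsDistanceExpanding f ξ lam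

/-- The (finite) indexed family `A` of nonempty sets is a Markov partition for `f`. -/
structure IsMarkovPartition {X ι : Type*} [TopologicalSpace X] (f : X → X) (A : ι → Set X) :
    Prop where
  cover : ⋃ i, A i = univ
  nonempty : ∀ i, (A i).Nonempty
  eq_closure_interior : ∀ i, A i = closure (interior (A i))
  disjoint_interior : ∀ i j, i ≠ j → interior (A i) ∩ interior (A j) = ∅
  markov : ∀ i j, (f '' interior (A i) ∩ interior (A j)).Nonempty →
    interior (A j) ⊆ f '' interior (A i)

/-! ## The tile graph -/

/-- Vertices of the tile graph: the finite words `u₁ ⋯ uₙ` (including the empty one) with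
`A (uᵢ₊₁) ⊆ f (A (uᵢ))` for all consecutive letters. -/
def Vertex {X ι : Type*} (f : X → X) (A : ι → Set X) : Type _ :=
  {u : List ι // u.IsChain fun i j => A j ⊆ f '' A i}

variable {X ι : Type*} {f : X → X} {A : ι → Set X}

instance [Finite ι] : Countable (Vertex f A) :=
  inferInstanceAs (Countable {u : List ι // u.IsChain fun i j => A j ⊆ f '' A i})

/-- The vertex set carries the discrete sigma-algebra. -/
instance : MeasurableSpace (Vertex f A) := ⊤

instance : DiscreteMeasurableSpace (Vertex f A) := ⟨fun _ => trivial⟩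

namespace Vertex

/-- The level `|u|`, i.e. the length of the word `u`. -/
def level (u : Vertex f A) : ℕ := u.1.length

/-- The base point `o`: the empty word. -/
def root : Vertex f A := ⟨[], List.isChain_nil⟩

/-- The shift `u₁ u₂ ⋯ uₙ ↦ u₂ ⋯ uₙ`; it sends words of length at most one to the empty word. -/
def shift (u : Vertex f A) : Vertex f A := ⟨u.1.tail, u.2.tail⟩

/-- The tile `A_u = A_{u₁} ∩ f⁻¹ A_{u₂} ∩ ⋯ ∩ f^{-(n-1)} A_{uₙ}`; it is the whole space for the
empty word. -/
def tile (u : Vertex f A) : Set X :=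
  {x | ∀ (k : ℕ) (hk : k < u.1.length), f^[k] x ∈ A u.1[k]}

end Vertex

/-- The tile graph: two different vertices are adjacent iff their levels differ by at most one and
their tiles intersect. -/
def tileGraph (f : X → X) (A : ι → Set X) : SimpleGraph (Vertex f A) where
  Adj u v := u ≠ v ∧ (u.level ≤ v.level + 1 ∧ v.level ≤ u.level + 1) ∧
    (u.tile ∩ v.tile).Nonempty
  symm := ⟨fun _ _ h => ⟨h.1.symm, h.2.1.symm, by rw [inter_comm]; exact h.2.2⟩⟩
  loopless := ⟨fun _ h => h.1 rfl⟩

/-- The combinatorial distance of the tile graph. -/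
def gdist (u v : Vertex f A) : ℕ := (tileGraph f A).dist u v

/-- The Gromov product of `u` and `v` with respect to the root. -/
def gromovProduct (u v : Vertex f A) : ℝ :=
  ((gdist u Vertex.root : ℝ) + gdist Vertex.root v - gdist u v) / 2

/-- Convergence of a sequence of vertices to `x : X`, where `X` is identified with the Gromov
boundary of the tile graph in the natural way: the sequence converges at infinity in the sense of
Gromov, and the boundary point that it represents corresponds to the point `x` to which the tiles
shrink in the Hausdorff distance. -/
def ConvergesToBoundaryPoint [MetricSpace X] (v : ℕ → Vertex f A) (x : X) : Prop :=
  Tendsto (fun p : ℕ × ℕ => gromovProduct (v p.1) (v p.2)) atTop atTop ∧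
  Tendsto (fun n => Metric.hausdorffEDist (v n).tile {x}) atTop (𝓝 0)

/-! ## Markov chains, Green function, Martin boundary -/

section Chain

variable {V : Type*}

/-- The distribution of the chain with transition probability `P` after `n` steps from `x`, so that
`stepDist P n x y` is the `n`-step transition probability from `x` to `y`. -/
def stepDist (P : V → PMF V) : ℕ → V → PMF V
  | 0, x => PMF.pure x
  | n + 1, x => (P x).bind (stepDist P n)

/-- The Green function: the expected number of visits to `y` starting from `x`. -/
def green (P : V → PMF V) (x y : V) : ℝ≥0∞ := ∑' n, stepDist P n x y

/-- The Martin kernel `K(x, y) = G(x, y) / G(o, y)`. -/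
def martinKernel (P : V → PMF V) (o x y : V) : ℝ := (green P x y / green P o y).toReal

/-- The map `y ↦ K(·, y)` into the space of functions with the topology of pointwise
convergence. -/
def martinEmbedding (P : V → PMF V) (o : V) (y : V) : V → ℝ := fun x => martinKernel P o x y

/-- The Martin boundary. For countable `V` the sigma-algebra that it inherits from the product
sigma-algebra on `V → ℝ` is its Borel sigma-algebra. -/
def martinBoundary (P : V → PMF V) (o : V) : Set (V → ℝ) :=
  closure (range (martinEmbedding P o)) \ range (martinEmbedding P o)

variable [MeasurableSpace V] [DiscreteMeasurableSpace V]

/-- The transition kernel `x ↦ P(x)` as a Markov kernel. -/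
def transitionKernel (P : V → PMF V) : Kernel V V where
  toFun x := (P x).toMeasure
  measurable' := Measurable.of_discrete

instance (P : V → PMF V) : IsMarkovKernel (transitionKernel P) :=
  ⟨fun x => PMF.toMeasure.isProbabilityMeasure (P x)⟩

/-- The kernel giving the law of step `n + 1` from the past up to time `n`: it depends only on the
state at time `n`. -/
def pastKernel (P : V → PMF V) (n : ℕ) : Kernel (Π _ : Finset.Iic n, V) V :=
  (transitionKernel P).comap (fun h => h ⟨n, Finset.mem_Iic.2 le_rfl⟩) (measurable_pi_apply _)

instance (P : V → PMF V) (n : ℕ) : IsMarkovKernel (pastKernel P n) :=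
  inferInstanceAs (IsMarkovKernel (Kernel.comap _ _ _))

/-- The law on the space of sample paths `ℕ → V` of the Markov chain with transition probability
`P` started at `x`. -/
def pathLaw (P : V → PMF V) (x : V) : Measure (ℕ → V) :=
  Kernel.traj (X := fun _ => V) (pastKernel P) 0 (fun _ => x)

/-- `μ` is the harmonic measure on the Martin boundary seen from `o`: the chain started at `o`
converges almost surely to a random point of the Martin boundary, and `μ` is the law of the
limit. -/
def IsMartinHarmonicMeasure (P : V → PMF V) (o : V) (μ : Measure (martinBoundary P o)) : Prop :=
  ∃ Zinf : (ℕ → V) → martinBoundary P o, Measurable Zinf ∧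
    (∀ᵐ ω ∂(pathLaw P o),
      Tendsto (fun n => martinEmbedding P o (ω n)) atTop (𝓝 (Zinf ω : V → ℝ))) ∧
    μ = (pathLaw P o).map Zinf

end Chain

/-! ## Random walks on the tile graph -/

/-- The assumptions on the transition probability `P` of a random walk on the tile graph. -/
structure IsAdmissibleWalk (P : Vertex f A → PMF (Vertex f A)) : Prop where
  /-- uniformly bounded jumps -/
  locality : ∃ R : ℝ, 0 < R ∧ ∀ x y, 0 < P x y → (gdist x y : ℝ) < R
  /-- each step strictly increases the level -/
  level_increasing : ∀ x y, 0 < P x y → x.level < y.level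
  /-- steps to neighbours on the next level have positive probability -/
  neighbours : ∀ x y : Vertex f A, y.level = x.level + 1 → gdist x y = 1 → 0 < P x y
  /-- the transition probability commutes with the shift away from the root -/
  shift_equivariant : ∀ u : Vertex f A, u ≠ Vertex.root →
    P u.shift = (P u).map Vertex.shift

/-- `Φ` is the natural surjection from the Martin boundary to `X`: the continuous extension of the
identity of the vertex set, where `X` is identified with the Gromov boundary of the tile graph. -/
structure IsNaturalSurjection [MetricSpace X] (P : Vertex f A → PMF (Vertex f A))
    (Φ : martinBoundary P Vertex.root → X) : Prop where
  continuous : Continuous Φ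
  surjective : Function.Surjective Φ
  extends_id : ∀ (v : ℕ → Vertex f A) (ζ : martinBoundary P Vertex.root),
    Tendsto (fun n => martinEmbedding P Vertex.root (v n)) atTop (𝓝 (ζ : Vertex f A → ℝ)) →
    ConvergesToBoundaryPoint v (Φ ζ)

end TileGraph

end

/-!
# Quasi-invariance of the harmonic measure of a random walk on the tile graph

*Natural surjection.* Every step of the walk raises the level and has bounded length in the graph,
and the tiles of level `n` have diameter `O(λ⁻ⁿ)`. Hence, if `G(u, v) ≠ 0`, every point of the tile
of `v` is within `C λ^{-|u|}` of every point of the tile of `u`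
(`IsAdmissibleWalk.exists_dist_le_of_green_ne_zero`). A point `ζ` of the Martin boundary is a
harmonic function with `ζ o = 1`, so that there are `u` of arbitrarily high level with `ζ u ≠ 0`
(`exists_level_ge_limit_ne_zero`). If `K(·, vₙ) → ζ`, then `G(u, vₙ) ≠ 0` for large `n`, so the tiles
of `vₙ` shrink to a point that `ζ` determines. This gives the map `Φ`, and its continuity, since
`ζ u ≠ 0` is an open condition. No estimate of the Green function is needed.

*Convergence to the Martin boundary.* By the Markov property, `G(o, u) K(u, v)` is the conditional
probability that the chain started at `o` visits `u`, given that it visits `v` and given the part of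
the path above the level of `v` (`ae_condExp_visits_eq`). As `v` runs along the path, the values are
those of a bounded reverse martingale, which converges by Lévy's downward theorem
(`ae_exists_tendsto_condExp_of_antitone`).

*Quasi-invariance.* Write `ν_u` for the law of the limit point in `X` of the walk from `u`. Because
the walk commutes with the shift away from the root, `f_* ν_u = ν_{σ u}` for `u ≠ o`, and thus
`f_* ν_o = ∑ P(o, u) ν_{σ u}`, a finite sum. It contains the term `P(o, i) ν_o` for each letter `i`,
so that `ν_o ≤ C f_* ν_o` (`law_le_smul_map`). On the other hand the walk from `o` reaches each
word `w` with positive probability, so that every `ν_w` is dominated by a multiple of `ν_o`, whence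
`f_* ν_o ≤ C ν_o` (`map_law_le_smul`). The measures `ν_u` do not appear explicitly below: the
inequalities are proved for the means of continuous functions after `n` steps (`stepMean`), and
passed to the limit.
-/

namespace TileGraph

/-! ### The Markov property of the path law -/

section PathLaw

variable {V : Type*} [Countable V] [MeasurableSpace V] [DiscreteMeasurableSpace V]

theorem measurableSet_coord_eq (n : ℕ) (z : V) : MeasurableSet {ω : ℕ → V | ω n = z} :=
  (measurableSet_singleton z).preimage (measurable_pi_apply (X := fun _ : ℕ => V) n)

instance isProbabilityMeasure_pathLaw (P : V → PMF V) (x : V) :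
    IsProbabilityMeasure (pathLaw P x) := by
  unfold pathLaw; infer_instance

theorem pathLaw_zero (P : V → PMF V) (x : V) : pathLaw P x {ω | ω 0 = x} = 1 := by
  have h := Kernel.traj_map_frestrictLe_apply (X := fun _ => V) (κ := pastKernel P) 0 0
    (fun _ => x)
  rw [Kernel.partialTraj_self] at h
  have h2 : pathLaw P x {ω | ω 0 = x} =
      ((pathLaw P x).map (Preorder.frestrictLe 0))
        {g | g ⟨0, Finset.mem_Iic.2 le_rfl⟩ = x} := by
    rw [Measure.map_apply (Preorder.measurable_frestrictLe 0) (by measurability)]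
    rfl
  rw [h2]
  unfold pathLaw
  rw [h, Kernel.id_apply]
  simp

/-- One step of the chain: given the past up to time `k`, the next state only depends on the
present. -/
theorem pathLaw_step (P : V → PMF V) (x : V) (k : ℕ) (S : Set (Π _ : Finset.Iic k, V)) (z w : V) :
    pathLaw P x (Preorder.frestrictLe (π := fun _ => V) k ⁻¹' S ∩ {ω | ω k = z} ∩
        {ω | ω (k + 1) = w}) =
      pathLaw P x (Preorder.frestrictLe (π := fun _ => V) k ⁻¹' S ∩ {ω | ω k = z}) * P z w := by
  have h := Kernel.partialTraj_compProd_eq_map_traj (X := fun _ => V) (κ := pastKernel P)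
    (Nat.zero_le k) (x₀ := fun _ => x)
  rw [← Kernel.traj_map_frestrictLe_apply] at h
  let T : Set (Π _ : Finset.Iic k, V) := S ∩ {g | g ⟨k, Finset.mem_Iic.2 le_rfl⟩ = z}
  have hT : MeasurableSet T := MeasurableSet.of_discrete
  have h1 : pathLaw P x (Preorder.frestrictLe (π := fun _ => V) k ⁻¹' S ∩ {ω | ω k = z} ∩
      {ω | ω (k + 1) = w}) =
      ((pathLaw P x).map fun ω => (Preorder.frestrictLe k ω, ω (k + 1))) (T ×ˢ {w}) := by
    rw [Measure.map_apply (by fun_prop) (hT.prod (measurableSet_singleton w))]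
    rfl
  have h2 : pathLaw P x (Preorder.frestrictLe (π := fun _ => V) k ⁻¹' S ∩ {ω | ω k = z}) =
      ((pathLaw P x).map (Preorder.frestrictLe k)) T := by
    rw [Measure.map_apply (by fun_prop) hT]
    rfl
  rw [h1, h2]
  unfold pathLaw
  rw [← h, Measure.compProd_apply_prod hT (measurableSet_singleton w)]
  rw [setLIntegral_congr_fun (g := fun _ => P z w) hT]
  · rw [setLIntegral_const, mul_comm]
  · rintro g ⟨-, hg⟩
    simp only [mem_ofPred_eq] at hg
    simp only [pastKernel, transitionKernel, Kernel.comap_apply, hg]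
    exact (P z).toMeasure_apply_singleton w (measurableSet_singleton w)

/-- Two finite measures on the path space with the same values on cylinders are equal. -/
theorem measure_ext_of_cylinder {μ ν : Measure (ℕ → V)} [IsFiniteMeasure μ] [IsFiniteMeasure ν]
    (h : ∀ (c : ℕ → V) (n : ℕ), μ {ω | ∀ i ≤ n, ω i = c i} = ν {ω | ∀ i ≤ n, ω i = c i}) :
    μ = ν := by
  have hmap : ∀ n, μ.map (Preorder.frestrictLe (π := fun _ => V) n) =
      ν.map (Preorder.frestrictLe (π := fun _ => V) n) := by
    intro n
    refine Measure.ext_of_singleton fun g => ?_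
    let c : ℕ → V := fun i => if hi : i ≤ n then g ⟨i, Finset.mem_Iic.2 hi⟩
      else g ⟨0, Finset.mem_Iic.2 (Nat.zero_le n)⟩
    have hc : Preorder.frestrictLe (π := fun _ => V) n ⁻¹' {g} = {ω | ∀ i ≤ n, ω i = c i} := by
      ext ω
      simp only [mem_preimage, mem_singleton_iff, mem_ofPred_eq]
      constructor
      · rintro rfl i hi
        simp [c, hi]
      · intro hω
        ext ⟨i, hi⟩
        have hi' := Finset.mem_Iic.1 hi
        simpa [c, hi'] using hω i hi'
    rw [Measure.map_apply (by fun_prop) (measurableSet_singleton g),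
      Measure.map_apply (by fun_prop) (measurableSet_singleton g), hc, h]
  refine IsProjectiveLimit.unique (P := fun I => ν.map I.restrict) ?_ fun _ => rfl
  intro I
  have hI : I ⊆ Finset.Iic (I.sup id) := I.subset_Iic_sup_id
  have h2 : I.restrict = Finset.restrict₂ (π := fun _ => V) hI ∘
      Preorder.frestrictLe (π := fun _ => V) (I.sup id) := rfl
  rw [h2, ← Measure.map_map (by fun_prop) (by fun_prop), hmap,
    Measure.map_map (by fun_prop) (by fun_prop)]
  rfl

/-- The Markov property at a fixed time: on an event of the past up to time `n`, the future after
time `n` given `ω n = z` is a path started at `z`. -/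
theorem pathLaw_markov (P : V → PMF V) (x : V) (n : ℕ) (S : Set (Π _ : Finset.Iic n, V)) (z : V)
    {C : Set (ℕ → V)} (hC : MeasurableSet C) :
    pathLaw P x (Preorder.frestrictLe (π := fun _ => V) n ⁻¹' S ∩ {ω | ω n = z} ∩
        {ω | (fun k => ω (n + k)) ∈ C}) =
      pathLaw P x (Preorder.frestrictLe (π := fun _ => V) n ⁻¹' S ∩ {ω | ω n = z}) *
        pathLaw P z C := by
  set B : Set (ℕ → V) := Preorder.frestrictLe (π := fun _ => V) n ⁻¹' S ∩ {ω | ω n = z} with hB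
  have hθ : Measurable fun (ω : ℕ → V) k => ω (n + k) :=
    measurable_pi_lambda _ fun k => measurable_pi_apply _
  have hBm : MeasurableSet B :=
    (MeasurableSet.of_discrete.preimage (by fun_prop)).inter
      (measurableSet_coord_eq n z)
  have hcyl : ∀ (c : ℕ → V) (m : ℕ), MeasurableSet {ω : ℕ → V | ∀ i ≤ m, ω i = c i} := by
    intro c m
    have : {ω : ℕ → V | ∀ i ≤ m, ω i = c i} = ⋂ i, ⋂ (_ : i ≤ m), (fun ω => ω i) ⁻¹' {c i} := by
      ext; simp
    rw [this]
    exact MeasurableSet.iInter fun i => MeasurableSet.iInter fun _ =>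
      (measurable_pi_apply i) (measurableSet_singleton _)
  have key : ((pathLaw P x).restrict B).map (fun ω k => ω (n + k)) =
      pathLaw P x B • pathLaw P z := by
    have : IsFiniteMeasure (pathLaw P x B • pathLaw P z) :=
      Measure.smul_finite _ (measure_ne_top _ _)
    refine measure_ext_of_cylinder fun c m => ?_
    rw [Measure.map_apply hθ (hcyl c m), Measure.restrict_apply (hθ (hcyl c m)),
      Measure.smul_apply, smul_eq_mul]
    induction m with
    | zero =>
      by_cases hz : c 0 = z
      · have h1 : (fun (ω : ℕ → V) k => ω (n + k)) ⁻¹' {ω | ∀ i ≤ 0, ω i = c i} ∩ B = B := by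
          refine inter_eq_right.2 ?_
          rintro ω ⟨-, hω⟩
          simp only [mem_ofPred_eq] at hω
          simp [hω, hz]
        have h2 : {ω : ℕ → V | ∀ i ≤ 0, ω i = c i} = {ω | ω 0 = z} := by
          ext; simp [hz]
        rw [h1, h2, pathLaw_zero, mul_one]
      · have h1 : (fun (ω : ℕ → V) k => ω (n + k)) ⁻¹' {ω | ∀ i ≤ 0, ω i = c i} ∩ B = ∅ := by
          refine eq_empty_of_forall_notMem ?_
          rintro ω ⟨h1, -, hω⟩
          simp only [mem_ofPred_eq] at hω
          have := h1 0 le_rfl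
          simp only [add_zero] at this
          exact hz (by rw [← this, hω])
        have h2 : pathLaw P z {ω : ℕ → V | ∀ i ≤ 0, ω i = c i} = 0 := by
          refine measure_mono_null ?_ ((prob_compl_eq_zero_iff (measurableSet_coord_eq 0 z)).2
              (pathLaw_zero P z))
          intro ω hω h
          simp only [mem_ofPred_eq] at h
          exact hz (by rw [← hω 0 le_rfl, h])
        rw [h1, h2, measure_empty, mul_zero]
    | succ m ih =>
      -- both sides pick up the factor `P (c m) (c (m + 1))`
      have h1 : (fun (ω : ℕ → V) k => ω (n + k)) ⁻¹' {ω | ∀ i ≤ m + 1, ω i = c i} ∩ B =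
          Preorder.frestrictLe (π := fun _ => V) (n + m) ⁻¹' {g | g ∈
            (Preorder.frestrictLe₂ (π := fun _ => V) (Nat.le_add_right n m) ⁻¹' S) ∧
            g ⟨n, Finset.mem_Iic.2 (Nat.le_add_right n m)⟩ = z ∧
            ∀ i (hi : i ≤ m), g ⟨n + i, Finset.mem_Iic.2 (by omega)⟩ = c i} ∩
          {ω | ω (n + m) = c m} ∩ {ω | ω (n + m + 1) = c (m + 1)} := by
        ext ω
        constructor
        · rintro ⟨h, hS, hz⟩
          exact ⟨⟨⟨hS, hz, fun i hi => h i (by omega)⟩, h m (by omega)⟩, h (m + 1) le_rfl⟩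
        · rintro ⟨⟨⟨hS, hz, h⟩, -⟩, h'⟩
          refine ⟨fun i hi => ?_, hS, hz⟩
          rcases Nat.lt_or_ge i (m + 1) with hi' | hi'
          · exact h i (by omega)
          · obtain rfl : i = m + 1 := by omega
            exact h'
      have h2 : (fun (ω : ℕ → V) k => ω (n + k)) ⁻¹' {ω | ∀ i ≤ m, ω i = c i} ∩ B =
          Preorder.frestrictLe (π := fun _ => V) (n + m) ⁻¹' {g | g ∈
            (Preorder.frestrictLe₂ (π := fun _ => V) (Nat.le_add_right n m) ⁻¹' S) ∧
            g ⟨n, Finset.mem_Iic.2 (Nat.le_add_right n m)⟩ = z ∧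
            ∀ i (hi : i ≤ m), g ⟨n + i, Finset.mem_Iic.2 (by omega)⟩ = c i} ∩
          {ω | ω (n + m) = c m} := by
        ext ω
        constructor
        · rintro ⟨h, hS, hz⟩
          exact ⟨⟨hS, hz, fun i hi => h i (by omega)⟩, h m (by omega)⟩
        · rintro ⟨⟨hS, hz, h⟩, -⟩
          exact ⟨fun i hi => h i hi, hS, hz⟩
      have h3 : {ω : ℕ → V | ∀ i ≤ m + 1, ω i = c i} =
          Preorder.frestrictLe (π := fun _ => V) m ⁻¹'
            {g | ∀ i (hi : i ≤ m), g ⟨i, Finset.mem_Iic.2 hi⟩ = c i} ∩ {ω | ω m = c m} ∩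
          {ω | ω (m + 1) = c (m + 1)} := by
        ext ω
        constructor
        · intro h
          exact ⟨⟨fun i hi => h i (by omega), h m (by omega)⟩, h (m + 1) le_rfl⟩
        · rintro ⟨⟨h, -⟩, h'⟩ i hi
          rcases Nat.lt_or_ge i (m + 1) with hi' | hi'
          · exact h i (by omega)
          · obtain rfl : i = m + 1 := by omega
            exact h'
      have h4 : {ω : ℕ → V | ∀ i ≤ m, ω i = c i} =
          Preorder.frestrictLe (π := fun _ => V) m ⁻¹'
            {g | ∀ i (hi : i ≤ m), g ⟨i, Finset.mem_Iic.2 hi⟩ = c i} ∩ {ω | ω m = c m} := by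
        ext ω
        exact ⟨fun h => ⟨fun i hi => h i hi, h m le_rfl⟩, fun h i hi => h.1 i hi⟩
      rw [h1, pathLaw_step, ← h2, ih, h3, pathLaw_step, ← h4, mul_assoc]
  have := congrArg (fun ν => ν C) key
  simp only [Measure.smul_apply, smul_eq_mul] at this
  rw [Measure.map_apply hθ hC, Measure.restrict_apply (hθ hC), inter_comm] at this
  exact this

end PathLaw

/-! ### Lévy's downward theorem -/

section ReverseMartingale

variable {Ω : Type*} {m0 : MeasurableSpace Ω} {μ : Measure Ω}

/-- If a sequence oscillates across `[a, b]`, then the sequences obtained by reversing time at `N`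
make arbitrarily many upcrossings when `N` is large. The count is over the reversed times before
`N - m`, that is, over the original indices larger than `m`. -/
theorem le_upcrossingsBefore_reverse {a b : ℝ} (hab : a < b) {y : ℕ → Ω → ℝ} {ω : Ω}
    (ha : ∃ᶠ n in atTop, y n ω < a) (hb : ∃ᶠ n in atTop, b < y n ω) (K m : ℕ) :
    ∃ M, ∀ N, M ≤ N → K ≤ upcrossingsBefore a b (fun k => y (N - k)) (N - m) ω := by
  induction K generalizing m with
  | zero => exact ⟨0, fun N _ => Nat.zero_le _⟩
  | succ K ih =>
    obtain ⟨n₂, hn₂, hb₂⟩ := frequently_atTop.1 hb (m + 1)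
    obtain ⟨n₁, hn₁, ha₁⟩ := frequently_atTop.1 ha n₂
    obtain ⟨M, hM⟩ := ih n₁
    refine ⟨max M n₁, fun N hN => ?_⟩
    have hMN : M ≤ N := (le_max_left _ _).trans hN
    have hnN : n₁ ≤ N := (le_max_right _ _).trans hN
    have h1 := upcrossingsBefore_lt_of_exists_upcrossing (f := fun k => y (N - k)) (ω := ω) hab
      (le_refl (N - n₁)) (by simpa [Nat.sub_sub_self hnN] using ha₁)
      (Nat.sub_le_sub_left hn₁ N)
      (by simpa [Nat.sub_sub_self (hn₁.trans hnN)] using hb₂)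
    have h2 := upcrossingsBefore_mono (f := fun k => y (N - k)) hab
      (show N - n₂ + 1 ≤ N - m by omega) ω
    simp only at h2
    have h3 := hM N hMN
    omega

/-- Lévy's downward theorem for bounded functions: the conditional expectations with respect to a
decreasing sequence of sigma-algebras converge almost surely. -/
theorem ae_exists_tendsto_condExp_of_antitone [IsProbabilityMeasure μ]
    {𝓖 : ℕ → MeasurableSpace Ω} (hanti : Antitone 𝓖) (hle : ∀ n, 𝓖 n ≤ m0) {f : Ω → ℝ} {R : ℝ}
    (hR : ∀ᵐ ω ∂μ, |f ω| ≤ R) :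
    ∀ᵐ ω ∂μ, ∃ c, Tendsto (fun n => (μ[f | 𝓖 n]) ω) atTop (𝓝 c) := by
  set y : ℕ → Ω → ℝ := fun n => μ[f | 𝓖 n] with hy
  let ℱ : ℕ → Filtration ℕ m0 := fun N =>
    ⟨fun k => 𝓖 (N - k), fun i j hij => hanti (Nat.sub_le_sub_left hij N), fun k => hle _⟩
  have hmart : ∀ N, Martingale (fun k => y (N - k)) (ℱ N) μ := fun N => martingale_condExp f (ℱ N) μ
  have hcross : ∀ a b : ℚ, a < b → ∀ᵐ ω ∂μ,
      ¬((∃ᶠ n in atTop, y n ω < a) ∧ ∃ᶠ n in atTop, (b : ℝ) < y n ω) := by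
    intro a b hab'
    have hab : (a : ℝ) < b := by exact_mod_cast hab'
    let U : ℕ → Ω → ℕ := fun N => upcrossingsBefore (a : ℝ) b (fun k => y (N - k)) N
    have hUm : ∀ N, Measurable (U N) := fun N =>
      (hmart N).stronglyAdapted.measurable_upcrossingsBefore hab
    set C : ℝ := (∫ ω, (y 0 ω - a)⁺ ∂μ) / (b - a) with hC
    have hUle : ∀ N, ∫⁻ ω, (U N ω : ℝ≥0∞) ∂μ ≤ ENNReal.ofReal C := by
      intro N
      have h1 := (hmart N).submartingale.mul_integral_upcrossingsBefore_le_integral_pos_part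
        (a : ℝ) b N
      have hint : Integrable (fun ω => (U N ω : ℝ)) μ :=
        (hmart N).stronglyAdapted.integrable_upcrossingsBefore hab
      have h2 : ∫⁻ ω, (U N ω : ℝ≥0∞) ∂μ = ENNReal.ofReal (∫ ω, (U N ω : ℝ) ∂μ) := by
        rw [ofReal_integral_eq_lintegral_ofReal hint (ae_of_all _ fun _ => Nat.cast_nonneg _)]
        simp
      rw [h2]
      refine ENNReal.ofReal_le_ofReal ?_
      rw [hC, le_div_iff₀ (sub_pos.2 hab), mul_comm]
      simpa using h1
    have hfin : ∀ᵐ ω ∂μ, liminf (fun N => (U N ω : ℝ≥0∞)) atTop < ∞ := by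
      refine ae_lt_top (.liminf fun N => measurable_from_top.comp (hUm N)) ?_
      refine ne_top_of_le_ne_top ENNReal.ofReal_ne_top
        ((lintegral_liminf_le fun N => measurable_from_top.comp (hUm N)).trans
          (?_ : _ ≤ ENNReal.ofReal C))
      refine (liminf_le_liminf (Eventually.of_forall hUle)).trans ?_
      simp
    filter_upwards [hfin] with ω hω ⟨ha, hb⟩
    refine hω.ne (ENNReal.eq_top_of_forall_nnreal_le fun r => ?_)
    obtain ⟨K, hK⟩ := exists_nat_ge r
    obtain ⟨M, hM⟩ := le_upcrossingsBefore_reverse hab ha hb K 0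
    refine le_liminf_of_le (by isBoundedDefault) ?_
    filter_upwards [eventually_ge_atTop M] with N hN
    calc (r : ℝ≥0∞) ≤ (K : ℝ≥0) := by exact_mod_cast hK
      _ ≤ (U N ω : ℝ≥0∞) := by
        have := hM N hN
        simp only [tsub_zero] at this
        exact_mod_cast this
  have hbdd : ∀ᵐ ω ∂μ, ∀ n, |y n ω| ≤ R :=
    ae_all_iff.2 fun n => ae_bdd_abs_condExp_of_ae_bdd_abs hR
  have hcross' : ∀ᵐ ω ∂μ, ∀ a b : ℚ, a < b →
      ¬((∃ᶠ n in atTop, y n ω < a) ∧ ∃ᶠ n in atTop, (b : ℝ) < y n ω) := by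
    refine ae_all_iff.2 fun a => ae_all_iff.2 fun b => ?_
    by_cases hab : a < b
    · filter_upwards [hcross a b hab] with ω hω _ using hω
    · exact ae_of_all _ fun _ h => absurd h hab
  filter_upwards [hbdd, hcross'] with ω h1 h2
  refine tendsto_of_no_upcrossings (s := range ((↑) : ℚ → ℝ)) Rat.denseRange_cast ?_ ?_ ?_
  · rintro _ ⟨a, rfl⟩ _ ⟨b, rfl⟩ hab
    exact h2 a b (by exact_mod_cast hab)
  · exact ⟨R, eventually_map.2 (Eventually.of_forall fun n => (abs_le.1 (h1 n)).2)⟩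
  · exact ⟨-R, eventually_map.2 (Eventually.of_forall fun n => (abs_le.1 (h1 n)).1)⟩

end ReverseMartingale

/-! ### Transition probabilities and the Green function -/

section StepDist

variable {V : Type*} (P : V → PMF V)

theorem stepDist_zero_self (x : V) : stepDist P 0 x x = 1 := by
  simp [stepDist]

theorem stepDist_succ_apply (n : ℕ) (x y : V) :
    stepDist P (n + 1) x y = ∑' z, P x z * stepDist P n z y := by
  simp [stepDist, PMF.bind_apply]

theorem stepDist_one (x y : V) : stepDist P 1 x y = P x y := by
  classical
  rw [stepDist_succ_apply, tsum_eq_single y]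
  · simp [stepDist]
  · intro z hz
    simp [stepDist, PMF.pure_apply, hz.symm]

theorem stepDist_add_apply (m n : ℕ) (x y : V) :
    stepDist P (m + n) x y = ∑' z, stepDist P m x z * stepDist P n z y := by
  classical
  induction m generalizing x with
  | zero =>
    rw [tsum_eq_single x]
    · simp [stepDist]
    · intro z hz
      simp [stepDist, PMF.pure_apply, hz]
  | succ m ih =>
    rw [Nat.add_right_comm, stepDist_succ_apply]
    simp_rw [ih, stepDist_succ_apply, ← ENNReal.tsum_mul_left, ← ENNReal.tsum_mul_right]
    rw [ENNReal.tsum_comm]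
    simp_rw [mul_assoc]

theorem stepDist_mul_le (m n : ℕ) (x z y : V) :
    stepDist P m x z * stepDist P n z y ≤ stepDist P (m + n) x y := by
  rw [stepDist_add_apply]
  exact ENNReal.le_tsum (f := fun z => stepDist P m x z * stepDist P n z y) z

theorem stepDist_mul_green_le (m : ℕ) (x z y : V) :
    stepDist P m x z * green P z y ≤ green P x y := by
  unfold green
  rw [← ENNReal.tsum_mul_left]
  calc ∑' n, stepDist P m x z * stepDist P n z y ≤ ∑' n, stepDist P (n + m) x y :=
        ENNReal.tsum_le_tsum fun n => by rw [add_comm]; exact stepDist_mul_le P m n x z y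
    _ ≤ ∑' n, stepDist P n x y :=
        ENNReal.tsum_comp_le_tsum_of_injective (add_left_injective m) _

theorem green_eq_add_tsum (x y : V) :
    green P x y = PMF.pure x y + ∑' z, P x z * green P z y := by
  unfold green
  rw [tsum_eq_zero_add' ENNReal.summable]
  simp_rw [stepDist_succ_apply, ← ENNReal.tsum_mul_left]
  rw [ENNReal.tsum_comm]
  rfl

theorem green_ne_zero_iff {x y : V} : green P x y ≠ 0 ↔ ∃ n, stepDist P n x y ≠ 0 := by
  simp [green, ENNReal.tsum_eq_zero]

theorem green_self_ne_zero (x : V) : green P x x ≠ 0 :=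
  (green_ne_zero_iff P).2 ⟨0, by simp [stepDist_zero_self]⟩

variable {P} {ℓ : V → ℕ} (hℓ : ∀ x y, P x y ≠ 0 → ℓ x < ℓ y)
include hℓ

theorem add_le_level_of_stepDist_ne_zero {n : ℕ} {x y : V} (h : stepDist P n x y ≠ 0) :
    ℓ x + n ≤ ℓ y := by
  induction n generalizing x with
  | zero =>
    obtain rfl : y = x := by simpa [stepDist] using h
    simp
  | succ n ih =>
    rw [stepDist_succ_apply, ne_eq, ENNReal.tsum_eq_zero, not_forall] at h
    obtain ⟨z, hz⟩ := h
    have h1 := hℓ x z (left_ne_zero_of_mul hz)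
    have h2 := ih (right_ne_zero_of_mul hz)
    omega

theorem level_le_of_green_ne_zero {x y : V} (h : green P x y ≠ 0) : ℓ x ≤ ℓ y := by
  obtain ⟨n, hn⟩ := (green_ne_zero_iff P).1 h
  have := add_le_level_of_stepDist_ne_zero hℓ hn
  omega

theorem green_ne_top (x y : V) : green P x y ≠ ∞ := by
  have h : ∀ n ∉ Finset.range (ℓ y + 1), stepDist P n x y = 0 := by
    intro n hn
    by_contra h
    have := add_le_level_of_stepDist_ne_zero hℓ h
    exact hn (Finset.mem_range.2 (by omega))
  rw [green, tsum_eq_sum h]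
  exact ENNReal.sum_ne_top.2 fun n _ => PMF.apply_ne_top _ _

end StepDist

/-! ### Visits and almost sure convergence of the Martin kernel -/

section Visits

variable {V : Type*} [Countable V] [MeasurableSpace V] [DiscreteMeasurableSpace V]

theorem pathLaw_coord_eq (P : V → PMF V) (x y : V) (n : ℕ) :
    pathLaw P x {ω | ω n = y} = stepDist P n x y := by
  induction n generalizing y with
  | zero =>
    by_cases h : x = y
    · subst h
      rw [pathLaw_zero, stepDist_zero_self]
    · classical
      have h0 : stepDist P 0 x y = 0 := by simp [stepDist, PMF.pure_apply, Ne.symm h]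
      rw [h0]
      refine measure_mono_null ?_ ((prob_compl_eq_zero_iff (measurableSet_coord_eq 0 x)).2
        (pathLaw_zero P x))
      intro ω (hω : ω 0 = y) (h' : ω 0 = x)
      exact h (h'.symm.trans hω)
  | succ n ih =>
    have h1 : {ω : ℕ → V | ω (n + 1) = y} =
        ⋃ z, ({ω | ω n = z} ∩ {ω : ℕ → V | ω (n + 1) = y}) := by
      ext ω; simp
    rw [h1, measure_iUnion, stepDist_add_apply]
    · refine tsum_congr fun z => ?_
      have := pathLaw_step P x n univ z y
      simp only [preimage_univ, univ_inter] at this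
      rw [this, ih, stepDist_one]
    · intro z z' hz
      refine Set.disjoint_left.2 ?_
      rintro ω ⟨h, -⟩ ⟨h', -⟩
      exact hz (Eq.trans (Eq.symm h) h')
    · exact fun z => (measurableSet_coord_eq n z).inter (measurableSet_coord_eq (n + 1) y)

theorem ae_pathLaw_step_ne_zero (P : V → PMF V) (x : V) :
    ∀ᵐ ω ∂pathLaw P x, ∀ n, P (ω n) (ω (n + 1)) ≠ 0 := by
  rw [ae_all_iff]
  intro n
  have h : ∀ z w, P z w = 0 → ∀ᵐ ω ∂pathLaw P x, ¬(ω n = z ∧ ω (n + 1) = w) := by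
    intro z w hzw
    have := pathLaw_step P x n univ z w
    simp only [preimage_univ, univ_inter, hzw, mul_zero] at this
    rw [ae_iff]
    simp only [not_not]
    exact this
  have h' : ∀ᵐ ω ∂pathLaw P x, ∀ z w, P z w = 0 → ¬(ω n = z ∧ ω (n + 1) = w) := by
    refine ae_all_iff.2 fun z => ae_all_iff.2 fun w => ?_
    by_cases hzw : P z w = 0
    · filter_upwards [h z w hzw] with ω hω _ using hω
    · exact ae_of_all _ fun _ h => absurd h hzw
  filter_upwards [h'] with ω hω h0
  exact hω _ _ h0 ⟨rfl, rfl⟩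

/-- The event that a path visits the state `w`. -/
def visits (w : V) : Set (ℕ → V) := {ω | ∃ n, ω n = w}

omit [Countable V] [MeasurableSpace V] [DiscreteMeasurableSpace V] in
theorem visits_eq_iUnion (w : V) : visits w = ⋃ n, {ω : ℕ → V | ω n = w} := by
  ext; simp [visits]

theorem measurableSet_visits (w : V) : MeasurableSet (visits w) := by
  rw [visits_eq_iUnion]
  exact MeasurableSet.iUnion fun n => measurableSet_coord_eq n w

variable {P : V → PMF V} {ℓ : V → ℕ} (hℓ : ∀ x y, P x y ≠ 0 → ℓ x < ℓ y)
include hℓ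

theorem ae_strictMono_level (x : V) : ∀ᵐ ω ∂pathLaw P x, StrictMono fun n => ℓ (ω n) := by
  filter_upwards [ae_pathLaw_step_ne_zero P x] with ω hω
  exact strictMono_nat_of_lt_succ fun n => hℓ _ _ (hω n)

/-- The strong Markov property at the time of the visit to `v`. The event `E` is a union, over the
possible times `n` of the visit, of events of the past up to time `n`; the event `A` only depends on
the path from the visit to `v` on. -/
theorem pathLaw_iUnion_inter (x v : V) (S : ∀ n : ℕ, Set (Π _ : Finset.Iic n, V))
    {A : Set (ℕ → V)} (hA : MeasurableSet A)
    (hfut : ∀ ω : ℕ → V, StrictMono (fun n => ℓ (ω n)) → ∀ n, ω n = v →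
      (ω ∈ A ↔ (fun k => ω (n + k)) ∈ A)) :
    pathLaw P x ((⋃ n, Preorder.frestrictLe (π := fun _ => V) n ⁻¹' S n ∩ {ω | ω n = v}) ∩ A) =
      pathLaw P x (⋃ n, Preorder.frestrictLe (π := fun _ => V) n ⁻¹' S n ∩ {ω | ω n = v}) *
        pathLaw P v A := by
  have hmeas : ∀ n, MeasurableSet
      (Preorder.frestrictLe (π := fun _ => V) n ⁻¹' S n ∩ {ω | ω n = v}) := fun n =>
    (MeasurableSet.of_discrete.preimage (by fun_prop)).inter (measurableSet_coord_eq n v)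
  have hdisj : Pairwise fun m n => AEDisjoint (pathLaw P x) {ω | ω m = v} {ω | ω n = v} := by
    intro m n hmn
    refine measure_mono_null ?_ (ae_iff.1 (ae_strictMono_level hℓ x))
    rintro ω ⟨hm, hn⟩ hω
    refine hmn (hω.injective ?_)
    simp only [mem_ofPred_eq] at hm hn
    simp only [hm, hn]
  rw [iUnion_inter, measure_iUnion₀, measure_iUnion₀, ← ENNReal.tsum_mul_right]
  · refine tsum_congr fun n => ?_
    rw [← pathLaw_markov P x n (S n) v hA]
    refine measure_congr ?_
    filter_upwards [ae_strictMono_level hℓ x] with ω hω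
    refine propext (and_congr_right fun h => ?_)
    exact hfut ω hω n h.2
  · exact fun m n hmn => (hdisj hmn).mono inter_subset_right inter_subset_right
  · exact fun n => (hmeas n).nullMeasurableSet
  · exact fun m n hmn => (hdisj hmn).mono (inter_subset_left.trans inter_subset_right)
      (inter_subset_left.trans inter_subset_right)
  · exact fun n => ((hmeas n).inter hA).nullMeasurableSet

theorem pathLaw_visits_inter (x v : V) {A : Set (ℕ → V)} (hA : MeasurableSet A)
    (hfut : ∀ ω : ℕ → V, StrictMono (fun n => ℓ (ω n)) → ∀ n, ω n = v →
      (ω ∈ A ↔ (fun k => ω (n + k)) ∈ A)) :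
    pathLaw P x (visits v ∩ A) = pathLaw P x (visits v) * pathLaw P v A := by
  have := pathLaw_iUnion_inter hℓ x v (fun _ => univ) hA hfut
  simpa only [preimage_univ, univ_inter, ← visits_eq_iUnion] using this

theorem pathLaw_visits (x v : V) : pathLaw P x (visits v) = green P x v := by
  rw [visits_eq_iUnion, measure_iUnion₀, green]
  · exact tsum_congr fun n => pathLaw_coord_eq P x v n
  · intro m n hmn
    refine measure_mono_null ?_ (ae_iff.1 (ae_strictMono_level hℓ x))
    rintro ω ⟨hm, hn⟩ hω
    refine hmn (hω.injective ?_)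
    simp only [mem_ofPred_eq] at hm hn
    simp only [hm, hn]
  · exact fun n => (measurableSet_coord_eq n v).nullMeasurableSet

omit hℓ [Countable V] [MeasurableSpace V] [DiscreteMeasurableSpace V] in
theorem mem_visits_iff_shift {ω : ℕ → V} (hω : StrictMono fun n => ℓ (ω n)) {n : ℕ} {v : V}
    (hn : ω n = v) {w : V} (hw : ℓ v ≤ ℓ w) :
    ω ∈ visits w ↔ (fun k => ω (n + k)) ∈ visits w := by
  constructor
  · rintro ⟨k, rfl⟩
    subst hn
    have hnk : n ≤ k := hω.le_iff_le.1 hw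
    exact ⟨k - n, by simp only [Nat.add_sub_cancel' hnk]⟩
  · rintro ⟨k, hk⟩
    exact ⟨n + k, hk⟩

theorem pathLaw_visits_inter_visits (x : V) {u v : V} (huv : ℓ u ≤ ℓ v) :
    pathLaw P x (visits u ∩ visits v) = green P x u * green P u v := by
  rw [pathLaw_visits_inter hℓ x u (measurableSet_visits v)
    fun ω hω n hn => mem_visits_iff_shift hω hn huv, pathLaw_visits hℓ, pathLaw_visits hℓ]

omit hℓ [Countable V] [MeasurableSpace V] [DiscreteMeasurableSpace V] in
/-- The sigma-algebra generated by the visits to states of level at least `L`. It decreases with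
`L`, and contains exactly the information on the part of the path above level `L`. -/
@[reducible] def tailSigma (ℓ : V → ℕ) (L : ℕ) : MeasurableSpace (ℕ → V) :=
  MeasurableSpace.generateFrom {A | ∃ w, L ≤ ℓ w ∧ A = visits w}

omit hℓ [MeasurableSpace V] [DiscreteMeasurableSpace V] [Countable V] in
theorem tailSigma_antitone (ℓ : V → ℕ) : Antitone (tailSigma ℓ) := by
  intro L M hLM
  refine MeasurableSpace.generateFrom_mono ?_
  rintro _ ⟨w, hw, rfl⟩
  exact ⟨w, hLM.trans hw, rfl⟩

omit hℓ in
theorem tailSigma_le (ℓ : V → ℕ) (L : ℕ) : tailSigma ℓ L ≤ MeasurableSpace.pi := by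
  refine MeasurableSpace.generateFrom_le ?_
  rintro _ ⟨w, -, rfl⟩
  exact measurableSet_visits w

omit hℓ [MeasurableSpace V] [DiscreteMeasurableSpace V] [Countable V] in
theorem mem_iff_shift_of_tailSigma {v : V} {A : Set (ℕ → V)}
    (hA : MeasurableSet[tailSigma ℓ (ℓ v)] A) {ω : ℕ → V} (hω : StrictMono fun n => ℓ (ω n))
    {n : ℕ} (hn : ω n = v) : ω ∈ A ↔ (fun k => ω (n + k)) ∈ A := by
  induction A, hA using MeasurableSpace.generateFrom_induction with
  | hC A hA _ =>
    obtain ⟨w, hw, rfl⟩ := hA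
    exact mem_visits_iff_shift hω hn hw
  | empty => simp
  | compl A _ ih => exact not_congr ih
  | iUnion f _ ih => simp only [mem_iUnion, ih]

/-- Given a visit to `v`, the part of the path above the level of `v` is independent of a visit to
another state `u` whose level is not larger. -/
theorem pathLaw_visits_inter_visits_inter (x : V) {u v : V} (huv : ℓ u ≤ ℓ v) {A : Set (ℕ → V)}
    (hA : MeasurableSet[tailSigma ℓ (ℓ v)] A) :
    pathLaw P x (visits u ∩ visits v ∩ A) =
      pathLaw P x (visits u ∩ visits v) * pathLaw P v A := by
  have hE : (visits u ∩ visits v : Set (ℕ → V)) =ᵐ[pathLaw P x]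
      (⋃ n, Preorder.frestrictLe (π := fun _ => V) n ⁻¹' {g | ∃ i, g i = u} ∩ {ω | ω n = v} :
        Set (ℕ → V)) := by
    filter_upwards [ae_strictMono_level hℓ x] with ω hω
    refine propext ?_
    change (_ ∧ _) ↔ ω ∈ (⋃ n, _)
    simp only [mem_iUnion]
    constructor
    · rintro ⟨⟨m, rfl⟩, n, rfl⟩
      exact ⟨n, ⟨⟨m, Finset.mem_Iic.2 (hω.le_iff_le.1 huv)⟩, rfl⟩, rfl⟩
    · rintro ⟨n, ⟨⟨m, hm⟩, h⟩, h'⟩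
      exact ⟨⟨m, h⟩, n, h'⟩
  rw [measure_congr hE, measure_congr (hE.inter (ae_eq_refl A))]
  exact pathLaw_iUnion_inter hℓ x v _ (tailSigma_le ℓ _ _ hA)
    fun ω hω n hn => mem_iff_shift_of_tailSigma hA hω hn

/-- On the visit to `v`, the conditional probability of a visit to `u`, given the part of the path
above the level of `v`, is the conditional probability given the visit to `v`, that is
`G(x, u) K(u, v)`. -/
theorem ae_condExp_visits_eq (x : V) {u v : V} (huv : ℓ u ≤ ℓ v) :
    ∀ᵐ ω ∂pathLaw P x, ω ∈ visits v →
      ((pathLaw P x)[(visits u).indicator (fun _ => (1 : ℝ)) | tailSigma ℓ (ℓ v)]) ω =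
        (green P x u).toReal * martinKernel P x u v := by
  set μ := pathLaw P x with hμ
  set m := tailSigma ℓ (ℓ v) with hm
  set k : ℝ := (green P x u).toReal * martinKernel P x u v with hk
  have hvm : MeasurableSet[m] (visits v) :=
    MeasurableSpace.measurableSet_generateFrom ⟨v, le_rfl, rfl⟩
  have hint : Integrable ((visits u).indicator fun _ => (1 : ℝ)) μ :=
    (integrable_const 1).indicator (measurableSet_visits u)
  have h1 := condExp_indicator (m := m) hint hvm
  have h2 : (visits v).indicator (fun _ => k) =ᵐ[μ]
      μ[(visits v).indicator ((visits u).indicator fun _ => (1 : ℝ)) | m] := by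
    refine ae_eq_condExp_of_forall_setIntegral_eq (tailSigma_le ℓ _)
      (hint.indicator (measurableSet_visits v)) ?_ ?_ ?_
    · exact fun s _ _ => ((integrable_const k).indicator (measurableSet_visits v)).integrableOn
    · intro s hs _
      have hs' := tailSigma_le ℓ _ _ hs
      rw [setIntegral_indicator (measurableSet_visits v), setIntegral_const,
        setIntegral_indicator (measurableSet_visits v),
        setIntegral_indicator (measurableSet_visits u), setIntegral_const, smul_eq_mul, smul_eq_mul,
        mul_one, measureReal_def, measureReal_def, inter_comm s (visits v), inter_comm _ (visits u),
        ← inter_assoc, pathLaw_visits_inter_visits_inter hℓ x huv hs,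
        pathLaw_visits_inter_visits hℓ x huv,
        pathLaw_visits_inter hℓ x v hs' fun ω hω n hn => mem_iff_shift_of_tailSigma hs hω hn,
        pathLaw_visits hℓ, hk, martinKernel]
      by_cases hv : green P x v = 0
      · have : green P x u * green P u v = 0 := by
          rw [← pathLaw_visits_inter_visits hℓ x huv]
          refine measure_mono_null inter_subset_right ?_
          rw [pathLaw_visits hℓ, hv]
        rw [hv, this]
        simp
      · have hv' : (green P x v).toReal ≠ 0 :=
          ENNReal.toReal_ne_zero.2 ⟨hv, green_ne_top hℓ x v⟩
        simp only [ENNReal.toReal_mul, ENNReal.toReal_div]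
        field_simp
    · exact (stronglyMeasurable_const.indicator hvm).aestronglyMeasurable
  filter_upwards [h1, h2] with ω h1 h2 hω
  rw [← h2, indicator_of_mem hω, indicator_of_mem hω] at h1
  exact h1.symm

/-- Almost sure convergence of the Martin kernel along the chain. -/
theorem ae_exists_tendsto_martinKernel (x : V) {u : V} (hu : green P x u ≠ 0) :
    ∀ᵐ ω ∂pathLaw P x, ∃ c, Tendsto (fun n => martinKernel P x u (ω n)) atTop (𝓝 c) := by
  have h1 : ∀ᵐ ω ∂pathLaw P x, ∃ c, Tendsto (fun L =>
      ((pathLaw P x)[(visits u).indicator (fun _ => (1 : ℝ)) | tailSigma ℓ L]) ω) atTop (𝓝 c) := by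
    refine ae_exists_tendsto_condExp_of_antitone (tailSigma_antitone ℓ) (tailSigma_le ℓ)
      (R := 1) (ae_of_all _ fun ω => ?_)
    by_cases h : ω ∈ visits u <;> simp [h]
  have h2 : ∀ᵐ ω ∂pathLaw P x, ∀ v, ℓ u ≤ ℓ v → ω ∈ visits v →
      ((pathLaw P x)[(visits u).indicator (fun _ => (1 : ℝ)) | tailSigma ℓ (ℓ v)]) ω =
        (green P x u).toReal * martinKernel P x u v := by
    refine ae_all_iff.2 fun v => ?_
    by_cases huv : ℓ u ≤ ℓ v
    · filter_upwards [ae_condExp_visits_eq hℓ x huv] with ω hω _ using hω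
    · exact ae_of_all _ fun _ h => absurd h huv
  filter_upwards [h1, h2, ae_strictMono_level hℓ x] with ω ⟨c, hc⟩ h2 hω
  have hu' : (green P x u).toReal ≠ 0 := ENNReal.toReal_ne_zero.2 ⟨hu, green_ne_top hℓ x u⟩
  refine ⟨(green P x u).toReal⁻¹ * c, ?_⟩
  refine ((hc.comp hω.tendsto_atTop).const_mul _).congr' ?_
  filter_upwards [hω.tendsto_atTop.eventually_ge_atTop (ℓ u)] with n hn
  simp only [Function.comp_apply]
  rw [h2 _ hn ⟨n, rfl⟩, inv_mul_cancel_left₀ hu']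

end Visits

/-! ### The Martin boundary and its harmonic measure -/

section Boundary

variable {V : Type*} {P : V → PMF V} {o : V}

theorem martinKernel_nonneg (x y : V) : 0 ≤ martinKernel P o x y := ENNReal.toReal_nonneg

theorem green_ne_zero_of_martinKernel_ne_zero {x y : V} (h : martinKernel P o x y ≠ 0) :
    green P x y ≠ 0 := by
  rintro h0
  exact h (by simp [martinKernel, h0])

variable {ℓ : V → ℕ} (hℓ : ∀ x y, P x y ≠ 0 → ℓ x < ℓ y) (ho : ∀ y, green P o y ≠ 0)
include hℓ ho

theorem martinKernel_root (y : V) : martinKernel P o o y = 1 := by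
  rw [martinKernel, ENNReal.div_self (ho y) (green_ne_top hℓ o y), ENNReal.toReal_one]

omit hℓ in
theorem exists_martinKernel_le (x : V) : ∃ C, ∀ y, martinKernel P o x y ≤ C := by
  obtain ⟨m, hm⟩ := (green_ne_zero_iff P).1 (ho x)
  refine ⟨((stepDist P m o x)⁻¹).toReal, fun y => ?_⟩
  refine ENNReal.toReal_mono (ENNReal.inv_ne_top.2 hm) ?_
  refine ENNReal.div_le_of_le_mul ?_
  calc green P x y = (stepDist P m o x)⁻¹ * (stepDist P m o x * green P x y) := by
        rw [← mul_assoc, ENNReal.inv_mul_cancel hm (PMF.apply_ne_top _ _), one_mul]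
    _ ≤ _ := by gcongr; exact stepDist_mul_green_le P m o x y

omit ho in
theorem martinKernel_eq_sum {x y : V} (hxy : x ≠ y) {s : Finset V} (hs : ∀ z ∉ s, P x z = 0) :
    martinKernel P o x y = ∑ z ∈ s, (P x z).toReal * martinKernel P o z y := by
  classical
  have h : green P x y = ∑ z ∈ s, P x z * green P z y := by
    rw [green_eq_add_tsum, PMF.pure_apply, if_neg hxy.symm, zero_add, tsum_eq_sum]
    intro z hz
    rw [hs z hz, zero_mul]
  rw [martinKernel, h, ENNReal.toReal_div, ENNReal.toReal_sum, Finset.sum_div]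
  · refine Finset.sum_congr rfl fun z _ => ?_
    rw [ENNReal.toReal_mul, martinKernel, ENNReal.toReal_div, mul_div_assoc]
  · exact fun z _ => ENNReal.mul_ne_top (PMF.apply_ne_top _ _) (green_ne_top hℓ z y)

variable (hsupp : ∀ x, {z | P x z ≠ 0}.Finite) (hlev : ∀ L, {v | ℓ v ≤ L}.Finite)

section Limit

variable {v : ℕ → V} {h : V → ℝ} (hv : Tendsto (fun n => ℓ (v n)) atTop atTop)
  (hlim : Tendsto (fun n => martinEmbedding P o (v n)) atTop (𝓝 h))

include hlim in
theorem limit_root_eq_one : h o = 1 :=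
  tendsto_nhds_unique ((tendsto_pi_nhds.1 hlim o).congr fun n => martinKernel_root hℓ ho (v n))
    tendsto_const_nhds

omit ho in
include hsupp hv hlim in
/-- The limit of the Martin kernels along a sequence that leaves every finite set is harmonic. -/
theorem limit_harmonic (x : V) : h x = ∑ z ∈ (hsupp x).toFinset, (P x z).toReal * h z := by
  refine tendsto_nhds_unique (tendsto_pi_nhds.1 hlim x) ?_
  refine (tendsto_finsetSum _ fun z _ => (tendsto_pi_nhds.1 hlim z).const_mul _).congr' ?_
  filter_upwards [hv.eventually_gt_atTop (ℓ x)] with n hn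
  refine (martinKernel_eq_sum hℓ (fun hx => ?_) fun z hz => ?_).symm
  · exact (hx ▸ hn).false
  · simpa using hz

include hsupp hv hlim in
theorem exists_level_ge_limit_ne_zero (L : ℕ) : ∃ u, L ≤ ℓ u ∧ h u ≠ 0 := by
  induction L with
  | zero => exact ⟨o, Nat.zero_le _, by rw [limit_root_eq_one hℓ ho hlim]; exact one_ne_zero⟩
  | succ L ih =>
    obtain ⟨u, hu, hu0⟩ := ih
    rw [limit_harmonic hℓ hsupp hv hlim u] at hu0
    obtain ⟨z, hz, hz0⟩ := Finset.exists_ne_zero_of_sum_ne_zero hu0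
    have := hℓ u z (by simpa using hz)
    exact ⟨z, by omega, right_ne_zero_of_mul hz0⟩

include hsupp hv hlim in
theorem limit_mem_martinBoundary : h ∈ martinBoundary P o := by
  refine ⟨mem_closure_of_tendsto hlim (Eventually.of_forall fun n => mem_range_self _), ?_⟩
  rintro ⟨w, rfl⟩
  obtain ⟨u, hu, hu0⟩ := exists_level_ge_limit_ne_zero hℓ ho hsupp hv hlim (ℓ w + 1)
  have := level_le_of_green_ne_zero hℓ (green_ne_zero_of_martinKernel_ne_zero hu0)
  omega

omit hℓ ho in
include hlim in
theorem eventually_green_ne_zero {u : V} (hu : h u ≠ 0) : ∀ᶠ n in atTop, green P u (v n) ≠ 0 := by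
  filter_upwards [(tendsto_pi_nhds.1 hlim u).eventually_ne hu] with n hn
  exact green_ne_zero_of_martinKernel_ne_zero hn

end Limit

omit hℓ ho in
include hlev in
/-- A sequence of states that converges to a point of the Martin boundary leaves every finite
set. -/
theorem tendsto_level_atTop {v : ℕ → V} {h : V → ℝ} (hh : h ∈ martinBoundary P o)
    (hlim : Tendsto (fun n => martinEmbedding P o (v n)) atTop (𝓝 h)) :
    Tendsto (fun n => ℓ (v n)) atTop atTop := by
  by_contra hcon
  simp only [tendsto_atTop, not_forall, not_eventually, not_le] at hcon
  obtain ⟨L, hL⟩ := hcon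
  have hfin : (martinEmbedding P o '' {v | ℓ v ≤ L}).Finite := (hlev L).image _
  have hmem : h ∈ closure (martinEmbedding P o '' {v | ℓ v ≤ L}) :=
    mem_closure_of_frequently_of_tendsto
      (hL.mono fun n hn => mem_image_of_mem _ (show ℓ (v n) ≤ L from hn.le)) hlim
  rw [hfin.isClosed.closure_eq] at hmem
  exact hh.2 (image_subset_range _ _ hmem)

omit hℓ ho in
theorem exists_seq_tendsto_martinBoundary [Countable V] {h : V → ℝ} (hh : h ∈ martinBoundary P o) :
    ∃ v : ℕ → V, Tendsto (fun n => martinEmbedding P o (v n)) atTop (𝓝 h) := by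
  obtain ⟨g, hg, hlim⟩ := mem_closure_iff_seq_limit.1 hh.1
  choose v hv using hg
  exact ⟨v, by simpa only [hv] using hlim⟩

include hsupp in
theorem exists_subseq_tendsto_martinBoundary [Countable V] {v : ℕ → V}
    (hv : Tendsto (fun n => ℓ (v n)) atTop atTop) :
    ∃ (ζ : martinBoundary P o) (φ : ℕ → ℕ), StrictMono φ ∧
      Tendsto (fun n => martinEmbedding P o (v (φ n))) atTop (𝓝 (ζ : V → ℝ)) := by
  choose C hC using exists_martinKernel_le ho
  have hcomp : IsCompact (pi univ fun x => Icc 0 (C x)) :=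
    isCompact_univ_pi fun x => isCompact_Icc
  obtain ⟨h, -, φ, hφ, hlim⟩ := hcomp.tendsto_subseq (x := fun n => martinEmbedding P o (v n))
    fun n x _ => ⟨martinKernel_nonneg _ _, hC x _⟩
  exact ⟨⟨h, limit_mem_martinBoundary hℓ ho hsupp (hv.comp hφ.tendsto_atTop) hlim⟩, φ, hφ, hlim⟩

include hsupp in
/-- The chain converges almost surely to a random point of the Martin boundary, and the law of this
point is well defined. -/
theorem existsUnique_isMartinHarmonicMeasure [Countable V] [MeasurableSpace V]
    [DiscreteMeasurableSpace V] :
    ∃! μ : Measure (martinBoundary P o), IsMartinHarmonicMeasure P o μ := by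
  have hae : ∀ᵐ ω ∂pathLaw P o, ∃ h : V → ℝ,
      Tendsto (fun n => martinEmbedding P o (ω n)) atTop (𝓝 h) := by
    filter_upwards [ae_all_iff.2 fun u => ae_exists_tendsto_martinKernel hℓ o (ho u)] with ω hω
    choose h hh using hω
    exact ⟨h, tendsto_pi_nhds.2 hh⟩
  have hemb : Measurable (martinEmbedding P o) := Measurable.of_discrete
  obtain ⟨g, hgm, hg⟩ := measurable_limit_of_tendsto_metrizable_ae
    (f := fun n (ω : ℕ → V) => martinEmbedding P o (ω n))
    (fun n => (hemb.comp (measurable_pi_apply n)).aemeasurable) hae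
  have hgmem : ∀ᵐ ω ∂pathLaw P o, g ω ∈ martinBoundary P o := by
    filter_upwards [hg, ae_strictMono_level hℓ o] with ω h1 h2
    exact limit_mem_martinBoundary hℓ ho hsupp h2.tendsto_atTop h1
  obtain ⟨ω₀, hω₀⟩ := hgmem.exists
  have hBm : MeasurableSet (martinBoundary P o) :=
    isClosed_closure.measurableSet.diff (countable_range _).measurableSet
  classical
  let Z : (ℕ → V) → martinBoundary P o := fun ω =>
    ⟨(g ⁻¹' martinBoundary P o).piecewise g (fun _ => g ω₀) ω, by
      by_cases hω : ω ∈ g ⁻¹' martinBoundary P o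
      · rw [piecewise_eq_of_mem _ _ _ hω]; exact hω
      · rw [piecewise_eq_of_notMem _ _ _ hω]; exact hω₀⟩
  have hZm : Measurable Z := (hgm.piecewise (hgm hBm) measurable_const).subtype_mk
  refine ⟨(pathLaw P o).map Z, ⟨Z, hZm, ?_, rfl⟩, ?_⟩
  · filter_upwards [hg, hgmem] with ω h1 h2
    have : (Z ω : V → ℝ) = g ω :=
      piecewise_eq_of_mem (g ⁻¹' martinBoundary P o) g (fun _ => g ω₀) h2
    rwa [this]
  · rintro _ ⟨Z', -, hZ', rfl⟩
    refine Measure.map_congr ?_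
    filter_upwards [hZ', hg, hgmem] with ω h1 h2 h3
    refine Subtype.ext ?_
    have : (Z ω : V → ℝ) = g ω :=
      piecewise_eq_of_mem (g ⁻¹' martinBoundary P o) g (fun _ => g ω₀) h3
    rw [this]
    exact tendsto_nhds_unique h1 h2

end Boundary

/-! ### Words and tiles -/

section Tiles

variable {X ι : Type*} {f : X → X} {A : ι → Set X}

namespace Vertex

@[simp] theorem level_root : (root : Vertex f A).level = 0 := rfl

theorem eq_root_of_level_eq_zero {u : Vertex f A} (h : u.level = 0) : u = root :=
  Subtype.ext (List.length_eq_zero_iff.1 h)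

@[simp] theorem level_shift (u : Vertex f A) : u.shift.level = u.level - 1 := by
  simp [level, shift]

/-- The prefix of length `L` of a word. -/
def take (u : Vertex f A) (L : ℕ) : Vertex f A := ⟨u.1.take L, u.2.take L⟩

theorem level_take (u : Vertex f A) (L : ℕ) : (u.take L).level = min L u.level := by
  simp [level, take]

theorem take_level (u : Vertex f A) : u.take u.level = u :=
  Subtype.ext (List.take_length ..)

theorem tile_subset_tile_take (u : Vertex f A) (L : ℕ) : u.tile ⊆ (u.take L).tile := by
  intro x hx k hk
  have hk' : k < u.1.length := by
    simp only [take, List.length_take] at hk; omega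
  simpa [take] using hx k hk'

theorem mapsTo_tile_shift (u : Vertex f A) : MapsTo f u.tile u.shift.tile := by
  intro x hx k hk
  have hk' : k + 1 < u.1.length := by
    simp only [shift, List.length_tail] at hk; omega
  have := hx (k + 1) hk'
  rw [Function.iterate_succ_apply] at this
  simpa [shift] using this

theorem tile_nonempty [Nonempty X] (hne : ∀ i, (A i).Nonempty) (u : Vertex f A) :
    u.tile.Nonempty := by
  obtain ⟨l, hl⟩ := u
  change ∃ x, ∀ (k : ℕ) (hk : k < l.length), f^[k] x ∈ A l[k]
  induction l with
  | nil => exact ⟨Classical.arbitrary X, fun k hk => absurd hk (Nat.not_lt_zero k)⟩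
  | cons i l ih =>
    obtain ⟨x, hxi, hx⟩ : ∃ x ∈ A i, ∀ (k : ℕ) (hk : k < l.length), f^[k + 1] x ∈ A l[k] := by
      cases l with
      | nil =>
        obtain ⟨x, hx⟩ := hne i
        exact ⟨x, hx, fun k hk => absurd hk (Nat.not_lt_zero k)⟩
      | cons j l =>
        obtain ⟨y, hy⟩ := ih hl.tail
        obtain ⟨x, hx, rfl⟩ := (List.isChain_cons_cons.1 hl).1 (hy 0 (Nat.succ_pos _))
        exact ⟨x, hx, fun k hk => by rw [Function.iterate_succ_apply]; exact hy k hk⟩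
    refine ⟨x, fun k hk => ?_⟩
    cases k with
    | zero => exact hxi
    | succ k => exact hx k (by simpa using hk)

theorem finite_level_le [Finite ι] (L : ℕ) : {v : Vertex f A | v.level ≤ L}.Finite :=
  (List.finite_length_le ι L).preimage Subtype.val_injective.injOn

theorem isClosed_tile [TopologicalSpace X] (hf : Continuous f) (hA : ∀ i, IsClosed (A i))
    (u : Vertex f A) : IsClosed u.tile := by
  have : u.tile = ⋂ k, ⋂ (hk : k < u.1.length), f^[k] ⁻¹' A u.1[k] := by
    ext; simp [tile]
  rw [this]
  exact isClosed_iInter fun k => isClosed_iInter fun hk => (hA _).preimage (hf.iterate k)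

end Vertex

/-! ### Paths and distances in the tile graph -/

theorem level_le_add_length {u v : Vertex f A} (w : (tileGraph f A).Walk u v) :
    v.level ≤ u.level + w.length ∧ u.level ≤ v.level + w.length := by
  induction w with
  | nil => simp
  | cons h w ih =>
    have := h.2.1
    simp only [SimpleGraph.Walk.length_cons]
    omega

variable (hne : ∀ u : Vertex f A, u.tile.Nonempty)
include hne

theorem tileGraph_adj_take (u : Vertex f A) {L : ℕ} (hL : L < u.level) :
    (tileGraph f A).Adj (u.take L) (u.take (L + 1)) := by
  have h1 := u.level_take L
  have h2 := u.level_take (L + 1)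
  refine ⟨fun h => ?_, by omega, ?_⟩
  · rw [← h] at h2; omega
  · obtain ⟨x, hx⟩ := hne u
    exact ⟨x, u.tile_subset_tile_take L hx, u.tile_subset_tile_take (L + 1) hx⟩

theorem exists_walk_take (u : Vertex f A) {L : ℕ} (hL : L ≤ u.level) :
    ∃ w : (tileGraph f A).Walk u (u.take L), w.length = u.level - L := by
  have key : ∀ k, L + k ≤ u.level →
      ∃ w : (tileGraph f A).Walk (u.take (L + k)) (u.take L), w.length = k := by
    intro k hk
    induction k with
    | zero => exact ⟨.nil, rfl⟩
    | succ k ih =>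
      obtain ⟨w, hw⟩ := ih (by omega)
      exact ⟨.cons (tileGraph_adj_take hne u (by omega : L + k < u.level)).symm w, by simp [hw]⟩
  have := key (u.level - L) (by omega)
  rwa [Nat.add_sub_cancel' hL, u.take_level] at this

theorem tileGraph_connected : (tileGraph f A).Connected := by
  have h : ∀ u : Vertex f A, (tileGraph f A).Reachable u Vertex.root := fun u =>
    (exists_walk_take hne u (Nat.zero_le _)).elim fun w _ => ⟨w⟩
  have : Nonempty (Vertex f A) := ⟨Vertex.root⟩
  exact ⟨fun u v => (h u).trans (h v).symm⟩

theorem level_le_add_gdist (u v : Vertex f A) : v.level ≤ u.level + gdist u v := by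
  obtain ⟨w, hw⟩ := ((tileGraph_connected hne) u v).exists_walk_length_eq_dist
  have := (level_le_add_length w).1
  rwa [hw] at this

theorem gdist_root (u : Vertex f A) : gdist u Vertex.root = u.level := by
  refine le_antisymm ?_ ?_
  · obtain ⟨w, hw⟩ := exists_walk_take hne u (Nat.zero_le _)
    exact (SimpleGraph.dist_le w).trans (by omega)
  · have := level_le_add_gdist hne Vertex.root u
    rw [gdist, SimpleGraph.dist_comm] at this
    simpa [gdist] using this

theorem le_gromovProduct {u v : Vertex f A} {L : ℕ} (hu : L ≤ u.level) (hv : L ≤ v.level)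
    (huv : ((u.take L).tile ∩ (v.take L).tile).Nonempty) : (L : ℝ) - 1 ≤ gromovProduct u v := by
  obtain ⟨w₁, hw₁⟩ := exists_walk_take hne u hu
  obtain ⟨w₂, hw₂⟩ := exists_walk_take hne v hv
  obtain ⟨w₃, hw₃⟩ : ∃ w : (tileGraph f A).Walk (u.take L) (v.take L), w.length ≤ 1 := by
    by_cases h : u.take L = v.take L
    · rw [h]; exact ⟨.nil, Nat.zero_le _⟩
    · have h1 := u.level_take L
      have h2 := v.level_take L
      have hadj : (tileGraph f A).Adj (u.take L) (v.take L) := ⟨h, by omega, huv⟩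
      exact ⟨hadj.toWalk, le_rfl⟩
  have h : gdist u v ≤ (u.level - L) + 1 + (v.level - L) := by
    refine (SimpleGraph.dist_le (w₁.append (w₃.append w₂.reverse))).trans ?_
    simp only [SimpleGraph.Walk.length_append, SimpleGraph.Walk.length_reverse]
    omega
  have h' : gdist u v + 2 * L ≤ u.level + v.level + 1 := by omega
  have h'' : (gdist u v : ℝ) + 2 * L ≤ u.level + v.level + 1 := by exact_mod_cast h'
  rw [gromovProduct, gdist_root hne, gdist, SimpleGraph.dist_comm, ← gdist, gdist_root hne]
  linarith

omit hne in
theorem tendsto_of_hausdorffEDist [MetricSpace X] {v : ℕ → Vertex f A} {x : X} {p : ℕ → X}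
    (hp : ∀ n, p n ∈ (v n).tile)
    (h : Tendsto (fun n => Metric.hausdorffEDist (v n).tile {x}) atTop (𝓝 0)) :
    Tendsto p atTop (𝓝 x) := by
  rw [tendsto_iff_edist_tendsto_0]
  refine tendsto_of_tendsto_of_tendsto_of_le_of_le tendsto_const_nhds h (fun _ => zero_le)
    fun n => ?_
  have := Metric.infEDist_le_hausdorffEDist_of_mem (t := {x}) (hp n)
  rwa [Metric.infEDist_singleton] at this

/-- If the levels go to infinity, then convergence at infinity in the sense of Gromov follows from
the convergence of the tiles. -/
theorem convergesToBoundaryPoint_of_hausdorffEDist [MetricSpace X] [Finite ι] (hf : Continuous f)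
    (hA : ∀ i, IsClosed (A i)) {v : ℕ → Vertex f A} {x : X}
    (hv : Tendsto (fun n => (v n).level) atTop atTop)
    (h : Tendsto (fun n => Metric.hausdorffEDist (v n).tile {x}) atTop (𝓝 0)) :
    ConvergesToBoundaryPoint v x := by
  refine ⟨?_, h⟩
  rw [tendsto_atTop]
  intro b
  obtain ⟨L, hL⟩ := exists_nat_ge (b + 1)
  choose p hp using fun n => hne (v n)
  have hpx := tendsto_of_hausdorffEDist hp h
  -- there are finitely many tiles of level at most `L`, and each of them is closed
  have h1 : ∀ᶠ n in atTop, ∀ w ∈ {w : Vertex f A | w.level ≤ L}, p n ∈ w.tile → x ∈ w.tile := by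
    refine (Vertex.finite_level_le L).eventually_all.2 fun w _ => ?_
    by_cases hx : x ∈ w.tile
    · exact Eventually.of_forall fun _ _ => hx
    · filter_upwards [hpx.eventually ((w.isClosed_tile hf hA).isOpen_compl.mem_nhds hx)]
        with n hn hn' using absurd hn' hn
  have h2 : ∀ᶠ n in atTop, L ≤ (v n).level ∧ x ∈ ((v n).take L).tile := by
    filter_upwards [h1, hv.eventually_ge_atTop L] with n hn hnL
    refine ⟨hnL, hn _ ?_ ((v n).tile_subset_tile_take L (hp n))⟩
    simp only [Vertex.level_take]
    omega
  rw [← prod_atTop_atTop_eq]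
  filter_upwards [h2.prod_mk h2] with n hn
  have := le_gromovProduct hne hn.1.1 hn.2.1 ⟨x, hn.1.2, hn.2.2⟩
  linarith

end Tiles

/-! ### Tiles of an expanding map -/

section Expanding

variable {X ι : Type*} [MetricSpace X] [CompactSpace X] {f : X → X} {A : ι → Set X} {ξ lam : ℝ}

omit [CompactSpace X] in
theorem IsMarkovPartition.isClosed (hA : IsMarkovPartition f A) (i : ι) : IsClosed (A i) := by
  rw [hA.eq_closure_interior i]; exact isClosed_closure

/-- If the tile of the letter `j` contains `f x`, then `j` can be preceded by a letter whose tile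
contains `x`. This is where the openness of `f` and the Markov property enter. -/
theorem exists_mem_of_apply_mem [Finite ι] (hf : Continuous f) (hopen : IsOpenMap f)
    (hA : IsMarkovPartition f A) {x : X} {j : ι} (hx : f x ∈ A j) :
    ∃ i, x ∈ A i ∧ A j ⊆ f '' A i := by
  let U : Set X := ⋂ i, ⋂ (_ : x ∉ A i), (A i)ᶜ
  have hU : IsOpen U := isOpen_iInter_of_finite fun i => isOpen_iInter_of_finite fun _ =>
    (hA.isClosed i).isOpen_compl
  have hxU : x ∈ U := by simp [U]
  have hfx : f x ∈ closure (interior (A j)) := by rwa [← hA.eq_closure_interior j]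
  obtain ⟨_, ⟨y, hyU, rfl⟩, hyj⟩ :=
    mem_closure_iff.1 hfx (f '' U) (hopen U hU) (mem_image_of_mem f hxU)
  obtain ⟨i, hi⟩ : ∃ i, y ∈ A i := by
    have : y ∈ ⋃ i, A i := hA.cover ▸ mem_univ y
    simpa using this
  rw [hA.eq_closure_interior i] at hi
  obtain ⟨w, ⟨hwU, hwj⟩, hwi⟩ := mem_closure_iff.1 hi (U ∩ f ⁻¹' interior (A j))
    (hU.inter (isOpen_interior.preimage hf)) ⟨hyU, hyj⟩
  refine ⟨i, ?_, ?_⟩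
  · by_contra hxi
    exact mem_iInter₂.1 hwU i hxi (interior_subset hwi)
  · have h1 := hA.markov i j ⟨f w, mem_image_of_mem f hwi, hwj⟩
    rw [hA.eq_closure_interior j]
    refine closure_minimal (h1.trans (image_mono interior_subset)) ?_
    exact ((hA.isClosed i).isCompact.image hf).isClosed

theorem exists_vertex_mem_tile [Finite ι] (hf : Continuous f) (hopen : IsOpenMap f)
    (hA : IsMarkovPartition f A) (x : X) (n : ℕ) : ∃ u : Vertex f A, u.level = n ∧ x ∈ u.tile := by
  induction n generalizing x with
  | zero => exact ⟨Vertex.root, rfl, fun k hk => absurd hk (Nat.not_lt_zero k)⟩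
  | succ n ih =>
    obtain ⟨⟨l, hl⟩, hln, hu⟩ := ih (f x)
    obtain ⟨i, hi, hil⟩ : ∃ i, x ∈ A i ∧ (i :: l).IsChain fun i j => A j ⊆ f '' A i := by
      cases l with
      | nil =>
        have : x ∈ ⋃ i, A i := hA.cover ▸ mem_univ x
        obtain ⟨i, hi⟩ := mem_iUnion.1 this
        exact ⟨i, hi, List.isChain_singleton i⟩
      | cons j l =>
        obtain ⟨i, hi, hij⟩ := exists_mem_of_apply_mem hf hopen hA
          (hu 0 (Nat.succ_pos _) : f x ∈ A j)
        exact ⟨i, hi, List.isChain_cons_cons.2 ⟨hij, hl⟩⟩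
    refine ⟨⟨i :: l, hil⟩, congrArg (· + 1) hln, fun k hk => ?_⟩
    cases k with
    | zero => exact hi
    | succ k =>
      rw [Function.iterate_succ_apply]
      exact hu k (by simpa using hk)

/-- The tiles of level `n` have diameter at most `C λ⁻ⁿ`. -/
theorem dist_le_of_mem_tile (hf : IsDistanceExpanding f ξ lam) (hmesh : ∀ i, Metric.diam (A i) < ξ)
    (u : Vertex f A) {x y : X} (hx : x ∈ u.tile) (hy : y ∈ u.tile) :
    dist x y ≤ max (lam * ξ) (Metric.diam (univ : Set X)) * lam⁻¹ ^ u.level := by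
  have hlam : 0 < lam := zero_lt_one.trans hf.one_lt_factor
  have hstep : ∀ k < u.level, dist (f^[k] x) (f^[k] y) ≤ ξ := fun k hk =>
    (Metric.dist_le_diam_of_mem Metric.isBounded_of_compactSpace (hx k hk) (hy k hk)).trans
      (hmesh _).le
  have hpow : ∀ k < u.level, lam ^ k * dist x y ≤ dist (f^[k] x) (f^[k] y) := by
    intro k hk
    induction k with
    | zero => simp
    | succ k ih =>
      rw [Function.iterate_succ_apply', Function.iterate_succ_apply', pow_succ', mul_assoc]
      exact (mul_le_mul_of_nonneg_left (ih (by omega)) hlam.le).trans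
        (hf.expanding _ _ (hstep k (by omega)))
  rcases Nat.eq_zero_or_pos u.level with h | h
  · rw [h, pow_zero, mul_one]
    exact (Metric.dist_le_diam_of_mem Metric.isBounded_of_compactSpace (mem_univ x)
      (mem_univ y)).trans (le_max_right _ _)
  · obtain ⟨n, hn⟩ := Nat.exists_eq_succ_of_ne_zero h.ne'
    have h1 := (hpow n (by omega)).trans (hstep n (by omega))
    calc dist x y ≤ (lam * ξ) * lam⁻¹ ^ u.level := by
          rw [hn, inv_pow, ← div_eq_mul_inv, le_div_iff₀ (by positivity), pow_succ]
          calc dist x y * (lam ^ n * lam) = lam * (lam ^ n * dist x y) := by ring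
            _ ≤ lam * ξ := by gcongr
      _ ≤ _ := by gcongr; exact le_max_left _ _

/-- Along a walk in the tile graph the level drops by at most one per step, so that the diameters of
the tiles grow at most by the factor `λ` per step. -/
theorem dist_le_of_walk (hf : IsDistanceExpanding f ξ lam) (hmesh : ∀ i, Metric.diam (A i) < ξ)
    {u v : Vertex f A} (w : (tileGraph f A).Walk u v) {x y : X} (hx : x ∈ u.tile)
    (hy : y ∈ v.tile) :
    dist x y ≤ (w.length + 1) * max (lam * ξ) (Metric.diam (univ : Set X)) * lam ^ w.length *
      lam⁻¹ ^ u.level := by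
  have hlam : 0 < lam := zero_lt_one.trans hf.one_lt_factor
  set C := max (lam * ξ) (Metric.diam (univ : Set X)) with hC
  have hC0 : 0 ≤ C := le_max_of_le_right Metric.diam_nonneg
  induction w generalizing x with
  | nil => simpa using dist_le_of_mem_tile hf hmesh _ hx hy
  | @cons u u' v h w ih =>
    obtain ⟨z, hz, hz'⟩ := h.2.2
    have h1 := dist_le_of_mem_tile hf hmesh _ hx hz
    have h2 := ih hz' hy
    have h3 : lam⁻¹ ^ u'.level ≤ lam * lam⁻¹ ^ u.level := by
      have : lam⁻¹ ^ (u'.level + 1) ≤ lam⁻¹ ^ u.level :=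
        pow_le_pow_of_le_one (inv_nonneg.2 hlam.le) (inv_le_one_of_one_le₀ hf.one_lt_factor.le)
          h.2.1.1
      calc lam⁻¹ ^ u'.level = lam * lam⁻¹ ^ (u'.level + 1) := by
            rw [pow_succ]; field_simp
        _ ≤ _ := by gcongr
    have h4 : (1 : ℝ) ≤ lam ^ (w.length + 1) := one_le_pow₀ hf.one_lt_factor.le
    rw [← hC] at h1
    calc dist x y ≤ dist x z + dist z y := dist_triangle _ _ _
      _ ≤ C * 1 * lam⁻¹ ^ u.level +
          (w.length + 1) * C * lam ^ w.length * (lam * lam⁻¹ ^ u.level) := by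
        rw [mul_one]
        exact add_le_add h1 (h2.trans (by gcongr))
      _ ≤ C * lam ^ (w.length + 1) * lam⁻¹ ^ u.level +
          (w.length + 1) * C * lam ^ w.length * (lam * lam⁻¹ ^ u.level) := by gcongr
      _ = _ := by
        rw [SimpleGraph.Walk.length_cons]; push_cast; ring

end Expanding

/-! ### Comparison of measures -/

section Comparison

/-- Finite measures on a metric space are compared by integrating bounded continuous functions. -/
theorem measure_le_smul_of_lintegral_le {X : Type*} [MetricSpace X] [MeasurableSpace X]
    [BorelSpace X] {μ ν : Measure X} [IsFiniteMeasure μ] [IsFiniteMeasure ν] {c : ℝ≥0∞}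
    (hc : c ≠ ∞) (h : ∀ g : BoundedContinuousFunction X ℝ≥0, ∫⁻ x, g x ∂μ ≤ c * ∫⁻ x, g x ∂ν) :
    μ ≤ c • ν := by
  have hclosed : ∀ F : Set X, IsClosed F → μ F ≤ c * ν F := by
    intro F hF
    have hpos : ∀ n : ℕ, (0 : ℝ) < 1 / (n + 1) := fun n => by positivity
    have hlim := tendsto_one_div_add_atTop_nhds_zero_nat (𝕜 := ℝ)
    exact le_of_tendsto_of_tendsto'
      (tendsto_lintegral_thickenedIndicator_of_isClosed μ hF hpos hlim)
      (ENNReal.Tendsto.const_mul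
        (tendsto_lintegral_thickenedIndicator_of_isClosed ν hF hpos hlim) (Or.inr hc))
      fun n => h (thickenedIndicator (hpos n) F)
  refine Measure.le_iff.2 fun s hs => ?_
  rw [hs.measure_eq_iSup_isClosed_of_ne_top (measure_ne_top μ s)]
  refine iSup₂_le fun F hFs => iSup_le fun hF => (hclosed F hF).trans ?_
  rw [Measure.smul_apply, smul_eq_mul]
  gcongr

theorem ae_rnDeriv_le_of_le_smul {X : Type*} [MeasurableSpace X] {μ ν : Measure X}
    [IsFiniteMeasure ν] {c : ℝ≥0∞} (h : μ ≤ c • ν) : ∀ᵐ x ∂ν, μ.rnDeriv ν x ≤ c := by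
  refine ae_le_of_forall_setLIntegral_le_of_sigmaFinite (Measure.measurable_rnDeriv μ ν)
    fun s _ _ => ?_
  rw [setLIntegral_const]
  exact (Measure.setLIntegral_rnDeriv_le s).trans (h s)

end Comparison

/-! ### Means along the chain -/

section StepMean

variable {V : Type*} (P : V → PMF V)

/-- The mean of `g` under the distribution of the chain after `n` steps from `x`. -/
noncomputable def stepMean (n : ℕ) (x : V) (g : V → ℝ≥0∞) : ℝ≥0∞ := ∑' v, stepDist P n x v * g v

theorem stepMean_succ (n : ℕ) (x : V) (g : V → ℝ≥0∞) :
    stepMean P (n + 1) x g = ∑' z, P x z * stepMean P n z g := by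
  simp_rw [stepMean, stepDist_succ_apply, ← ENNReal.tsum_mul_left, ← ENNReal.tsum_mul_right]
  rw [ENNReal.tsum_comm]
  simp_rw [mul_assoc]

theorem stepDist_mul_stepMean_le (m n : ℕ) (x z : V) (g : V → ℝ≥0∞) :
    stepDist P m x z * stepMean P n z g ≤ stepMean P (m + n) x g := by
  rw [stepMean, ← ENNReal.tsum_mul_left]
  refine ENNReal.tsum_le_tsum fun v => ?_
  rw [← mul_assoc]
  gcongr
  exact stepDist_mul_le P m n x z v

theorem lintegral_coord_eq_stepMean [Countable V] [MeasurableSpace V] [DiscreteMeasurableSpace V]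
    (n : ℕ) (x : V) (g : V → ℝ≥0∞) : ∫⁻ ω, g (ω n) ∂pathLaw P x = stepMean P n x g := by
  have h : ∫⁻ ω, g (ω n) ∂pathLaw P x = ∫⁻ v, g v ∂(pathLaw P x).map fun ω => ω n :=
    (lintegral_map .of_discrete (measurable_pi_apply n)).symm
  rw [h, lintegral_countable', stepMean]
  refine tsum_congr fun v => ?_
  rw [Measure.map_apply (measurable_pi_apply n) (measurableSet_singleton v), mul_comm,
    ← pathLaw_coord_eq]
  rfl

/-- If `q` of the chain converges almost surely to `Y`, then the means of `g ∘ q` converge to the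
integral of `g` with respect to the law of `Y`. -/
theorem tendsto_stepMean [Countable V] [MeasurableSpace V] [DiscreteMeasurableSpace V]
    {X : Type*} [MetricSpace X] [MeasurableSpace X] [BorelSpace X] {x : V} {q : V → X}
    {Y : (ℕ → V) → X} (hY : Measurable Y)
    (hq : ∀ᵐ ω ∂pathLaw P x, Tendsto (fun n => q (ω n)) atTop (𝓝 (Y ω)))
    (g : BoundedContinuousFunction X ℝ≥0) :
    Tendsto (fun n => stepMean P n x fun v => (g (q v) : ℝ≥0∞)) atTop
      (𝓝 (∫⁻ y, g y ∂(pathLaw P x).map Y)) := by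
  have hg : Measurable fun y => (g y : ℝ≥0∞) := g.continuous.measurable.coe_nnreal_ennreal
  rw [lintegral_map hg hY]
  simp_rw [← lintegral_coord_eq_stepMean]
  refine tendsto_lintegral_of_dominated_convergence (fun _ => (nndist g 0 : ℝ≥0∞)) ?_ ?_ ?_ ?_
  · exact fun n => (Measurable.of_discrete (f := fun v => (g (q v) : ℝ≥0∞))).comp
      (measurable_pi_apply n)
  · refine fun n => ae_of_all _ fun ω => ?_
    have := g.apply_le_nndist_zero (q (ω n))
    rw [nndist_comm] at this
    exact ENNReal.coe_le_coe.2 this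
  · simp
  · filter_upwards [hq] with ω hω
    exact ENNReal.tendsto_coe.2 ((g.continuous.tendsto _).comp hω)

end StepMean

/-! ### Admissible walks -/

section Walk

variable {X ι : Type*} {f : X → X} {A : ι → Set X} {P : Vertex f A → PMF (Vertex f A)}

theorem exists_step_ne_zero {V : Type*} (P : V → PMF V) (x : V) : ∃ y, P x y ≠ 0 := by
  obtain ⟨y, hy⟩ := (P x).support_nonempty
  exact ⟨y, (PMF.mem_support_iff _ _).1 hy⟩

namespace IsAdmissibleWalk

variable (hP : IsAdmissibleWalk P)
include hP

theorem level_lt {x y : Vertex f A} (h : P x y ≠ 0) : x.level < y.level :=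
  hP.level_increasing x y (pos_iff_ne_zero.2 h)

theorem ne_root {x y : Vertex f A} (h : P x y ≠ 0) : y ≠ Vertex.root := by
  rintro rfl
  exact Nat.not_lt_zero _ (hP.level_lt h)

theorem nonempty_space (hne : ∀ i, (A i).Nonempty) : Nonempty X := by
  obtain ⟨⟨l, hl⟩, hy⟩ := exists_step_ne_zero P Vertex.root
  cases l with
  | nil => exact absurd (hP.level_lt hy) (Nat.lt_irrefl _)
  | cons i l => exact ⟨(hne i).some⟩

theorem stepDist_shift (n : ℕ) {y : Vertex f A} (hy : y ≠ Vertex.root) :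
    stepDist P n y.shift = (stepDist P n y).map Vertex.shift := by
  induction n generalizing y with
  | zero => simp only [stepDist, PMF.pure_map]
  | succ n ih =>
    simp only [stepDist]
    rw [hP.shift_equivariant y hy, PMF.bind_map, PMF.map_bind]
    ext w
    rw [PMF.bind_apply, PMF.bind_apply]
    refine tsum_congr fun z => ?_
    by_cases hz : P y z = 0
    · simp [hz]
    · rw [Function.comp_apply, ih (hP.ne_root hz)]

theorem stepMean_shift (n : ℕ) {y : Vertex f A} (hy : y ≠ Vertex.root)
    (g : Vertex f A → ℝ≥0∞) :
    stepMean P n y.shift g = stepMean P n y fun v => g v.shift := by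
  classical
  rw [stepMean, hP.stepDist_shift n hy, stepMean]
  simp_rw [PMF.map_apply, ← ENNReal.tsum_mul_right]
  rw [ENNReal.tsum_comm]
  refine tsum_congr fun v => ?_
  rw [tsum_eq_single v.shift]
  · simp
  · intro w hw
    simp [hw]

variable (hne : ∀ u : Vertex f A, u.tile.Nonempty)
include hne

theorem step_take_ne_zero (u : Vertex f A) {L : ℕ} (hL : L < u.level) :
    P (u.take L) (u.take (L + 1)) ≠ 0 := by
  have h1 := u.level_take L
  have h2 := u.level_take (L + 1)
  exact (hP.neighbours _ _ (by omega)
    (SimpleGraph.dist_eq_one_iff_adj.2 (tileGraph_adj_take hne u hL))).ne'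

theorem green_root_ne_zero (u : Vertex f A) : green P Vertex.root u ≠ 0 := by
  have key : ∀ k ≤ u.level, green P Vertex.root (u.take k) ≠ 0 := by
    intro k hk
    induction k with
    | zero => exact green_self_ne_zero P _
    | succ k ih =>
      obtain ⟨n, hn⟩ := (green_ne_zero_iff P).1 (ih (by omega))
      refine (green_ne_zero_iff P).2 ⟨n + 1, fun h0 => ?_⟩
      have := stepDist_mul_le P n 1 Vertex.root (u.take k) (u.take (k + 1))
      rw [h0, stepDist_one, nonpos_iff_eq_zero, mul_eq_zero] at this
      exact this.elim hn (hP.step_take_ne_zero hne u (by omega))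
  simpa only [u.take_level] using key u.level le_rfl

theorem finite_steps [Finite ι] (x : Vertex f A) : {z | P x z ≠ 0}.Finite := by
  obtain ⟨R, -, hR⟩ := hP.locality
  refine (Vertex.finite_level_le (x.level + ⌈R⌉₊)).subset fun z hz => ?_
  have h1 := hR x z (pos_iff_ne_zero.2 hz)
  have h2 : gdist x z ≤ ⌈R⌉₊ := by exact_mod_cast h1.le.trans (Nat.le_ceil R)
  have h3 := level_le_add_gdist hne x z
  exact h3.trans (by omega)

/-- If the walk can pass from `u` to `v`, then the tile of `v` is close to the tile of `u`, on the
scale `λ^{-|u|}` of the latter: the jumps are bounded in the graph, and the levels increase, so that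
the displacements are bounded by a geometric series. -/
theorem exists_dist_le_of_green_ne_zero [MetricSpace X] [CompactSpace X] {ξ lam : ℝ}
    (hf : IsDistanceExpanding f ξ lam) (hmesh : ∀ i, Metric.diam (A i) < ξ) :
    ∃ C : ℝ, ∀ u v : Vertex f A, green P u v ≠ 0 → ∀ x ∈ u.tile, ∀ y ∈ v.tile,
      dist x y ≤ C * lam⁻¹ ^ u.level := by
  have hlam : 0 < lam := zero_lt_one.trans hf.one_lt_factor
  have hθ0 : 0 ≤ lam⁻¹ := inv_nonneg.2 hlam.le
  have hθ1 : lam⁻¹ < 1 := inv_lt_one_of_one_lt₀ hf.one_lt_factor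
  obtain ⟨R, -, hR⟩ := hP.locality
  set D := max (lam * ξ) (Metric.diam (univ : Set X)) with hD
  have hD0 : 0 ≤ D := le_max_of_le_right Metric.diam_nonneg
  set B : ℝ := (⌈R⌉₊ + 1) * D * lam ^ ⌈R⌉₊ with hB
  have hB0 : 0 ≤ B := by positivity
  have hDB : D ≤ B := by
    have h1 : (1 : ℝ) ≤ lam ^ ⌈R⌉₊ := one_le_pow₀ hf.one_lt_factor.le
    calc D = (0 + 1) * D * 1 := by ring
      _ ≤ B := by rw [hB]; gcongr; positivity
  have hBC : B ≤ B / (1 - lam⁻¹) := by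
    rw [le_div_iff₀ (by linarith)]
    nlinarith
  have hstep : ∀ u v : Vertex f A, P u v ≠ 0 → ∀ x ∈ u.tile, ∀ y ∈ v.tile,
      dist x y ≤ B * lam⁻¹ ^ u.level := by
    intro u v huv x hx y hy
    obtain ⟨w, hw⟩ := ((tileGraph_connected hne) u v).exists_walk_length_eq_dist
    have h1 := hR u v (pos_iff_ne_zero.2 huv)
    have h2 : w.length ≤ ⌈R⌉₊ := by
      rw [hw]; exact_mod_cast h1.le.trans (Nat.le_ceil R)
    refine (dist_le_of_walk hf hmesh w hx hy).trans ?_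
    have h3 : lam ^ w.length ≤ lam ^ ⌈R⌉₊ := pow_le_pow_right₀ hf.one_lt_factor.le h2
    rw [hB, ← hD]
    gcongr
  refine ⟨B / (1 - lam⁻¹), fun u v huv => ?_⟩
  obtain ⟨n, hn⟩ := (green_ne_zero_iff P).1 huv
  clear huv
  induction n generalizing u with
  | zero =>
    intro x hx y hy
    obtain rfl : v = u := by simpa [stepDist] using hn
    exact (dist_le_of_mem_tile hf hmesh _ hx hy).trans (by gcongr; exact hDB.trans hBC)
  | succ n ih =>
    intro x hx y hy
    rw [stepDist_succ_apply, ne_eq, ENNReal.tsum_eq_zero, not_forall] at hn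
    obtain ⟨w, hw⟩ := hn
    obtain ⟨z, hz⟩ := hne w
    have h1 := hstep u w (left_ne_zero_of_mul hw) x hx z hz
    have h2 := ih w (right_ne_zero_of_mul hw) z hz y hy
    have h3 : lam⁻¹ ^ w.level ≤ lam⁻¹ ^ (u.level + 1) :=
      pow_le_pow_of_le_one hθ0 hθ1.le (hP.level_lt (left_ne_zero_of_mul hw))
    have h4 : 0 ≤ B / (1 - lam⁻¹) := hB0.trans hBC
    calc dist x y ≤ dist x z + dist z y := dist_triangle _ _ _
      _ ≤ B * lam⁻¹ ^ u.level + B / (1 - lam⁻¹) * lam⁻¹ ^ (u.level + 1) :=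
        add_le_add h1 (h2.trans (by gcongr))
      _ = B / (1 - lam⁻¹) * lam⁻¹ ^ u.level := by
        have : 1 - lam⁻¹ ≠ 0 := by linarith
        rw [pow_succ]
        generalize lam⁻¹ = θ at this ⊢
        field_simp
        ring

end IsAdmissibleWalk

end Walk

/-! ### The natural surjection -/

section NaturalSurjection

variable {X ι : Type*} [MetricSpace X] [CompactSpace X] [Finite ι] {f : X → X} {A : ι → Set X}
  {ξ lam : ℝ} {P : Vertex f A → PMF (Vertex f A)}

theorem existsUnique_isNaturalSurjection (hf : IsExpandingSystem f ξ lam)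
    (hA : IsMarkovPartition f A) (hmesh : ∀ i, Metric.diam (A i) < ξ) (hP : IsAdmissibleWalk P) :
    ∃! Φ : martinBoundary P Vertex.root → X, IsNaturalSurjection P Φ := by
  have : Nonempty X := hP.nonempty_space hA.nonempty
  have hne := Vertex.tile_nonempty (f := f) hA.nonempty
  have hℓ : ∀ x y, P x y ≠ 0 → x.level < y.level := fun x y => hP.level_lt
  have ho := hP.green_root_ne_zero hne
  have hsupp := hP.finite_steps hne
  have hlev := Vertex.finite_level_le (f := f) (A := A)
  obtain ⟨C, hC⟩ := hP.exists_dist_le_of_green_ne_zero hne hf.expanding hmesh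
  have hlam : 0 < lam := zero_lt_one.trans hf.expanding.one_lt_factor
  have hθ0 : 0 ≤ lam⁻¹ := inv_nonneg.2 hlam.le
  have hθ1 : lam⁻¹ < 1 := inv_lt_one_of_one_lt₀ hf.expanding.one_lt_factor
  choose p hp using hne
  -- the tiles of all `u` with `ζ u ≠ 0` are close to a point that depends only on `ζ`
  have hex : ∀ ζ : martinBoundary P Vertex.root, ∃ x : X, ∀ u, (ζ : Vertex f A → ℝ) u ≠ 0 →
      ∀ a ∈ u.tile, dist a x ≤ C * lam⁻¹ ^ u.level := by
    intro ζ
    obtain ⟨v, hv⟩ := exists_seq_tendsto_martinBoundary ζ.2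
    obtain ⟨x, -, φ, hφ, hx⟩ := isCompact_univ.tendsto_subseq (x := fun n => p (v n))
      fun n => mem_univ _
    refine ⟨x, fun u hu a ha => le_of_tendsto (tendsto_const_nhds.dist hx) ?_⟩
    filter_upwards [hφ.tendsto_atTop.eventually (eventually_green_ne_zero hv hu)] with n hn
    exact hC u _ hn a ha _ (hp _)
  choose Φ hΦ using hex
  have hdeep : ∀ (ζ : martinBoundary P Vertex.root) (ε : ℝ), 0 < ε →
      ∃ u, (ζ : Vertex f A → ℝ) u ≠ 0 ∧ 2 * (C * lam⁻¹ ^ u.level) < ε := by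
    intro ζ ε hε
    have hlim : Tendsto (fun n : ℕ => 2 * (C * lam⁻¹ ^ n)) atTop (𝓝 0) := by
      simpa using ((tendsto_pow_atTop_nhds_zero_of_lt_one hθ0 hθ1).const_mul C).const_mul 2
    obtain ⟨N, hN⟩ := eventually_atTop.1 (hlim.eventually_lt_const hε)
    obtain ⟨v, hv⟩ := exists_seq_tendsto_martinBoundary ζ.2
    obtain ⟨u, hu, hu0⟩ := exists_level_ge_limit_ne_zero hℓ ho hsupp
      (tendsto_level_atTop hlev ζ.2 hv) hv N
    exact ⟨u, hu0, hN _ hu⟩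
  have hext : ∀ (v : ℕ → Vertex f A) (ζ : martinBoundary P Vertex.root),
      Tendsto (fun n => martinEmbedding P Vertex.root (v n)) atTop (𝓝 (ζ : Vertex f A → ℝ)) →
      ConvergesToBoundaryPoint v (Φ ζ) := by
    intro v ζ hv
    refine convergesToBoundaryPoint_of_hausdorffEDist (fun u => ⟨p u, hp u⟩) hf.continuous
      hA.isClosed (tendsto_level_atTop hlev ζ.2 hv) ?_
    refine ENNReal.tendsto_nhds_zero.2 fun ε hε => ?_
    obtain ⟨δ, hδ, hδε⟩ : ∃ δ : ℝ, 0 < δ ∧ ENNReal.ofReal δ ≤ ε := by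
      obtain ⟨δ, hδ, hδε⟩ := ENNReal.lt_iff_exists_nnreal_btwn.1 hε
      exact ⟨δ, by exact_mod_cast hδ, by rw [ENNReal.ofReal_coe_nnreal]; exact hδε.le⟩
    obtain ⟨u, hu, huδ⟩ := hdeep ζ δ hδ
    filter_upwards [eventually_green_ne_zero hv hu] with n hn
    have key : ∀ b ∈ (v n).tile, edist b (Φ ζ) ≤ ε := by
      intro b hb
      refine le_trans ?_ hδε
      rw [edist_dist]
      refine ENNReal.ofReal_le_ofReal ?_
      have h1 := hC u _ hn _ (hp u) b hb
      have h2 := hΦ ζ u hu _ (hp u)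
      have h3 := dist_triangle_left b (Φ ζ) (p u)
      linarith
    refine Metric.hausdorffEDist_le_of_mem_edist (fun b hb => ⟨_, rfl, key b hb⟩) ?_
    rintro _ rfl
    exact ⟨p (v n), hp _, by rw [edist_comm]; exact key _ (hp _)⟩
  refine ⟨Φ, ⟨?_, ?_, hext⟩, ?_⟩
  · refine continuous_iff_continuousAt.2 fun ζ => Metric.tendsto_nhds.2 fun ε hε => ?_
    obtain ⟨u, hu, huε⟩ := hdeep ζ ε hε
    have hcont : Continuous fun ζ : martinBoundary P Vertex.root => (ζ : Vertex f A → ℝ) u :=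
      (continuous_apply u).comp continuous_subtype_val
    filter_upwards [hcont.continuousAt.eventually_ne hu] with ζ' hζ'
    have h1 := hΦ ζ u hu _ (hp u)
    have h2 := hΦ ζ' u hζ' _ (hp u)
    have h3 := dist_triangle_left (Φ ζ') (Φ ζ) (p u)
    linarith
  · intro x
    choose v hv hxv using exists_vertex_mem_tile hf.continuous hf.isOpenMap hA x
    obtain ⟨ζ, φ, hφ, hlim⟩ := exists_subseq_tendsto_martinBoundary (ℓ := Vertex.level) hℓ ho hsupp
      (v := v) (tendsto_id.congr fun n => (hv n).symm)
    refine ⟨ζ, ?_⟩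
    exact tendsto_nhds_unique (tendsto_of_hausdorffEDist (fun n => hxv (φ n)) (hext _ ζ hlim).2)
      tendsto_const_nhds
  · intro Φ' hΦ'
    ext1 ζ
    obtain ⟨v, hv⟩ := exists_seq_tendsto_martinBoundary ζ.2
    exact tendsto_nhds_unique
      (tendsto_of_hausdorffEDist (fun n => hp (v n)) (hΦ'.extends_id v ζ hv).2)
      (tendsto_of_hausdorffEDist (fun n => hp (v n)) (hext v ζ hv).2)

end NaturalSurjection

/-! ### Quasi-invariance of the harmonic measure -/

section QuasiInvariance

variable {X ι : Type*} [MetricSpace X] {f : X → X} {A : ι → Set X}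
  {P : Vertex f A → PMF (Vertex f A)}

/-- The law `ν` of the limit point is dominated by a multiple of its image. The walk from the root
steps with positive probability to a word with one letter; from there, the shifted walk is a walk
from the root. -/
theorem law_le_smul_map [MeasurableSpace X] [BorelSpace X] (hP : IsAdmissibleWalk P)
    (hne : ∀ u : Vertex f A, u.tile.Nonempty)
    {ν ν' : Measure X} [IsFiniteMeasure ν] [IsFiniteMeasure ν'] {p : Vertex f A → X}
    (hν : ∀ g : BoundedContinuousFunction X ℝ≥0, Tendsto
      (fun n => stepMean P n Vertex.root fun v => (g (p v) : ℝ≥0∞)) atTop (𝓝 (∫⁻ y, g y ∂ν)))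
    (hν' : ∀ g : BoundedContinuousFunction X ℝ≥0, Tendsto
      (fun n => stepMean P n Vertex.root fun v => (g (p v.shift) : ℝ≥0∞)) atTop
      (𝓝 (∫⁻ y, g y ∂ν'))) :
    ∃ c : ℝ≥0, ν ≤ (c : ℝ≥0∞) • ν' := by
  obtain ⟨u, hu⟩ := exists_step_ne_zero P Vertex.root
  have hstep : P Vertex.root (u.take 1) ≠ 0 := hP.step_take_ne_zero hne u (hP.level_lt hu)
  have hshift : (u.take 1).shift = Vertex.root := Vertex.eq_root_of_level_eq_zero (by
    rw [Vertex.level_shift, Vertex.level_take]; omega)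
  have hc : (P Vertex.root (u.take 1))⁻¹ ≠ ∞ := ENNReal.inv_ne_top.2 hstep
  refine ⟨(P Vertex.root (u.take 1))⁻¹.toNNReal, ?_⟩
  rw [ENNReal.coe_toNNReal hc]
  refine measure_le_smul_of_lintegral_le hc fun g => ?_
  refine le_of_tendsto_of_tendsto' (hν g)
    (ENNReal.Tendsto.const_mul ((hν' g).comp (tendsto_add_atTop_nat 1)) (Or.inr hc)) fun n => ?_
  have h1 : P Vertex.root (u.take 1) * stepMean P n Vertex.root (fun v => (g (p v) : ℝ≥0∞)) ≤
      stepMean P (n + 1) Vertex.root fun v => (g (p v.shift) : ℝ≥0∞) := by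
    have h2 := hP.stepMean_shift n (hP.ne_root hstep) fun v => (g (p v) : ℝ≥0∞)
    rw [hshift] at h2
    rw [h2, stepMean_succ]
    exact ENNReal.le_tsum (f := fun z => P Vertex.root z *
      stepMean P n z fun v => (g (p v.shift) : ℝ≥0∞)) (u.take 1)
  calc stepMean P n Vertex.root (fun v => (g (p v) : ℝ≥0∞))
      = (P Vertex.root (u.take 1))⁻¹ * (P Vertex.root (u.take 1) *
          stepMean P n Vertex.root fun v => (g (p v) : ℝ≥0∞)) := by
        rw [← mul_assoc, ENNReal.inv_mul_cancel hstep (PMF.apply_ne_top _ _), one_mul]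
    _ ≤ _ := by gcongr; exact h1

/-- The image of the law of the limit point is dominated by a multiple of this law. After the first
step, the shifted walk is a walk from one of finitely many words, and all of these can be reached
from the root. -/
theorem map_law_le_smul [MeasurableSpace X] [BorelSpace X] [Finite ι] (hP : IsAdmissibleWalk P)
    (hne : ∀ u : Vertex f A, u.tile.Nonempty)
    {ν ν' : Measure X} [IsFiniteMeasure ν] [IsFiniteMeasure ν'] {p : Vertex f A → X}
    (hν : ∀ g : BoundedContinuousFunction X ℝ≥0, Tendsto
      (fun n => stepMean P n Vertex.root fun v => (g (p v) : ℝ≥0∞)) atTop (𝓝 (∫⁻ y, g y ∂ν)))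
    (hν' : ∀ g : BoundedContinuousFunction X ℝ≥0, Tendsto
      (fun n => stepMean P n Vertex.root fun v => (g (p v.shift) : ℝ≥0∞)) atTop
      (𝓝 (∫⁻ y, g y ∂ν'))) :
    ∃ c : ℝ≥0, ν' ≤ (c : ℝ≥0∞) • ν := by
  set S := (hP.finite_steps hne Vertex.root).toFinset with hS
  choose m hm using fun y : Vertex f A =>
    (green_ne_zero_iff P).1 (hP.green_root_ne_zero hne y.shift)
  set c : ℝ≥0∞ := ∑ y ∈ S, (stepDist P (m y) Vertex.root y.shift)⁻¹ with hc
  have hctop : c ≠ ∞ := ENNReal.sum_ne_top.2 fun y _ => ENNReal.inv_ne_top.2 (hm y)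
  refine ⟨c.toNNReal, ?_⟩
  rw [ENNReal.coe_toNNReal hctop]
  refine measure_le_smul_of_lintegral_le hctop fun g => ?_
  have hlim : Tendsto (fun n => ∑ y ∈ S, (stepDist P (m y) Vertex.root y.shift)⁻¹ *
      stepMean P (m y + n) Vertex.root fun v => (g (p v) : ℝ≥0∞)) atTop
      (𝓝 (c * ∫⁻ y, g y ∂ν)) := by
    rw [hc, Finset.sum_mul]
    refine tendsto_finsetSum _ fun y _ => ENNReal.Tendsto.const_mul ?_
      (Or.inr (ENNReal.inv_ne_top.2 (hm y)))
    exact (hν g).comp (tendsto_atTop_mono (fun n => Nat.le_add_left n (m y)) tendsto_id)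
  refine le_of_tendsto_of_tendsto' ((hν' g).comp (tendsto_add_atTop_nat 1)) hlim fun n => ?_
  rw [Function.comp_apply, stepMean_succ, tsum_eq_sum (s := S)]
  · refine Finset.sum_le_sum fun y hy => ?_
    have hy' : P Vertex.root y ≠ 0 := by simpa [hS] using hy
    rw [← hP.stepMean_shift n (hP.ne_root hy') fun v => (g (p v) : ℝ≥0∞)]
    calc P Vertex.root y * stepMean P n y.shift (fun v => (g (p v) : ℝ≥0∞))
        ≤ 1 * stepMean P n y.shift (fun v => (g (p v) : ℝ≥0∞)) := by
          gcongr; exact PMF.coe_le_one _ _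
      _ = (stepDist P (m y) Vertex.root y.shift)⁻¹ * (stepDist P (m y) Vertex.root y.shift *
            stepMean P n y.shift fun v => (g (p v) : ℝ≥0∞)) := by
          rw [← mul_assoc, ENNReal.inv_mul_cancel (hm y) (PMF.apply_ne_top _ _)]
      _ ≤ _ := by gcongr; exact stepDist_mul_stepMean_le P _ _ _ _ _
  · intro y hy
    have hy' : P Vertex.root y = 0 := by simpa [hS] using hy
    rw [hy', zero_mul]

/-- If the walk converges to `x`, then the shifted walk converges to `f x`. -/
theorem tendsto_of_mem_tile_shift [CompactSpace X] {ξ lam : ℝ} (hf : IsExpandingSystem f ξ lam)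
    (hmesh : ∀ i, Metric.diam (A i) < ξ) {p : Vertex f A → X} (hp : ∀ u, p u ∈ u.tile)
    {v : ℕ → Vertex f A} {x : X} (hv : Tendsto (fun n => (v n).level) atTop atTop)
    (hx : Tendsto (fun n => p (v n)) atTop (𝓝 x)) :
    Tendsto (fun n => p (v n).shift) atTop (𝓝 (f x)) := by
  have hlam : 0 < lam := zero_lt_one.trans hf.expanding.one_lt_factor
  have hlim : Tendsto (fun n => max (lam * ξ) (Metric.diam (univ : Set X)) *
      lam⁻¹ ^ ((v n).level - 1)) atTop (𝓝 0) := by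
    have h1 := (tendsto_pow_atTop_nhds_zero_of_lt_one (inv_nonneg.2 hlam.le)
      (inv_lt_one_of_one_lt₀ hf.expanding.one_lt_factor)).comp ((tendsto_sub_atTop_nat 1).comp hv)
    simpa using h1.const_mul (max (lam * ξ) (Metric.diam (univ : Set X)))
  refine ((hf.continuous.tendsto x).comp hx).congr_dist ?_
  refine squeeze_zero (fun _ => dist_nonneg) (fun n => ?_) hlim
  rw [← Vertex.level_shift]
  exact dist_le_of_mem_tile hf.expanding hmesh _ ((v n).mapsTo_tile_shift (hp _)) (hp _)

end QuasiInvariance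

end TileGraph

theorem theorem1p5 {X : Type*} [MetricSpace X] [CompactSpace X] [MeasurableSpace X] [BorelSpace X]
    {ι : Type*} [Finite ι] (f : X → X) (ξ lam : ℝ) (hf : TileGraph.IsExpandingSystem f ξ lam)
    (A : ι → Set X) (hA : TileGraph.IsMarkovPartition f A)
    (hmesh : ∀ i, Metric.diam (A i) < ξ)
    (P : TileGraph.Vertex f A → PMF (TileGraph.Vertex f A))
    (hP : TileGraph.IsAdmissibleWalk P) :
    -- the natural surjection and the harmonic measure on the Martin boundary are well defined
    (∃! Φ : TileGraph.martinBoundary P TileGraph.Vertex.root → X,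
      TileGraph.IsNaturalSurjection P Φ) ∧
    (∃! μ : Measure (TileGraph.martinBoundary P TileGraph.Vertex.root),
      TileGraph.IsMartinHarmonicMeasure P TileGraph.Vertex.root μ) ∧
    -- and the harmonic measure on `X`, their push-forward, is quasi-invariant
    ∀ (Φ : TileGraph.martinBoundary P TileGraph.Vertex.root → X)
      (μ : Measure (TileGraph.martinBoundary P TileGraph.Vertex.root)) (ν : Measure X),
      TileGraph.IsNaturalSurjection P Φ →
      TileGraph.IsMartinHarmonicMeasure P TileGraph.Vertex.root μ →
      ν = μ.map Φ →
      ν ≪ ν.map f ∧ ν.map f ≪ ν ∧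
      ∃ C : ℝ≥0, (∀ᵐ x ∂(ν.map f), ν.rnDeriv (ν.map f) x ≤ C) ∧
        (∀ᵐ x ∂ν, (ν.map f).rnDeriv ν x ≤ C) := by
  have : Nonempty X := hP.nonempty_space hA.nonempty
  have hne := TileGraph.Vertex.tile_nonempty (f := f) hA.nonempty
  have hℓ : ∀ x y, P x y ≠ 0 → x.level < y.level := fun x y => hP.level_lt
  refine ⟨TileGraph.existsUnique_isNaturalSurjection hf hA hmesh hP,
    TileGraph.existsUnique_isMartinHarmonicMeasure hℓ (hP.green_root_ne_zero hne)
      (hP.finite_steps hne), ?_⟩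
  rintro Φ _ ν hΦ ⟨Z, hZ, hlim, rfl⟩ hν
  choose p hp using id hne
  have hY : Measurable (Φ ∘ Z) := hΦ.continuous.measurable.comp hZ
  have hfm : Measurable f := hf.continuous.measurable
  rw [Measure.map_map hΦ.continuous.measurable hZ] at hν
  have hν' : ν.map f = (TileGraph.pathLaw P TileGraph.Vertex.root).map (f ∘ Φ ∘ Z) := by
    rw [hν, Measure.map_map hfm hY]
  have hfin : IsFiniteMeasure ν := by rw [hν]; infer_instance
  have hpY : ∀ᵐ ω ∂TileGraph.pathLaw P TileGraph.Vertex.root,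
      Tendsto (fun n => p (ω n)) atTop (𝓝 ((Φ ∘ Z) ω)) := by
    filter_upwards [hlim] with ω hω
    exact TileGraph.tendsto_of_hausdorffEDist (fun n => hp _) (hΦ.extends_id _ _ hω).2
  have hpfY : ∀ᵐ ω ∂TileGraph.pathLaw P TileGraph.Vertex.root,
      Tendsto (fun n => p (ω n).shift) atTop (𝓝 ((f ∘ Φ ∘ Z) ω)) := by
    filter_upwards [hpY, TileGraph.ae_strictMono_level hℓ _] with ω h1 h2
    exact TileGraph.tendsto_of_mem_tile_shift hf hmesh hp h2.tendsto_atTop h1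
  have hmean := TileGraph.tendsto_stepMean P hY hpY
  have hmean' := TileGraph.tendsto_stepMean P (q := fun v => p v.shift) (hfm.comp hY) hpfY
  rw [← hν] at hmean
  rw [← hν'] at hmean'
  obtain ⟨c, hc⟩ := TileGraph.law_le_smul_map hP hne hmean hmean'
  obtain ⟨c', hc'⟩ := TileGraph.map_law_le_smul hP hne hmean hmean'
  refine ⟨Measure.absolutelyContinuous_of_le_smul hc, Measure.absolutelyContinuous_of_le_smul hc',
    max c c', ?_, ?_⟩
  · filter_upwards [TileGraph.ae_rnDeriv_le_of_le_smul hc] with x hx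
    exact hx.trans (by exact_mod_cast le_max_left c c')
  · filter_upwards [TileGraph.ae_rnDeriv_le_of_le_smul hc'] with x hx
    exact hx.trans (by exact_mod_cast le_max_right c c')
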